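/- For an integrable function $g:\mathbb R\to\mathbb R$ write $g^*(t)=\int e^{it\mu}g(\mu)\,d\mu$. Let $H_j(x)=(-1)^je^{x^2}\frac{d^j}{dx^j}e^{-x^2}$ be the Hermite polynomials, $h_j(x)=(2^jj!\sqrt\pi)^{-1/2}H_j(x)e^{-x^2/2}$ the Hermite functions, and, for $g\in L^2(\mathbb R)$, let $\Pi_p(g)=\sum_{j=0}^{p}\alpha_jh_j$ with $\alpha_j=\int g\,h_j$ be the projection of $g$ onto the first $p+1$ Hermite functions. For real $b,C_{\mathrm{sob}},C_{\mathrm{herm}}$ let $\mathcal S(b,C_{\mathrm{sob}})$ be the set of probability distributions $G$ on $\mathbb R$ that have a Lebesgue density $g=G'\in L^1\cap L^2$ with $\int|g^*(t)|^2(t^2+1)^b\,dt\le 2\pi C_{\mathrm{sob}}$, and let $\mathcal S(b,C_{\mathrm{sob}},C_{\mathrm{herm}})$ be the set of those $G\in\mathcal S(b,C_{\mathrm{sob}})$ whose density also satisfies $\int\mu^2g(\mu)^2\,d\mu\le C_{\mathrm{herm}}$. Distributions are identified with their densities, and $\Pi_p(\mathcal S(b,C_{\mathrm{sob}},C_{\mathrm{herm}}))$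 is the set of the functions $\Pi_p(g)$, $g=G'$, $G\in\mathcal S(b,C_{\mathrm{sob}},C_{\mathrm{herm}})$; these are signed densities in general. Let $\psi^*:\mathbb R\to\mathbb C$ be measurable with $|\psi^*(t)|\le C_\psi$ for all $t$, and let $$L(g)=\frac1{2\pi}\int\psi^*(-t)\,g^*(t)\,dt .$$ Let $\hat L=Q_0+\frac1m\sum_{i=1}^mQ(X_i)$, $m\ge1$, be a linear estimator with $Q_0\in\mathbb R$ and $Q:\mathbb R\to\mathbb R$ measurable and bounded, where $X_i\mid\mu_i\sim\mathcal N(\mu_i,1)$ and $\mu_i\sim G$. With $\varphi$ the standard normal density, its bias at a (possibly signed) density $g$ is $$\operatorname{Bias}_g[\hat L,L]=Q_0+\int Q(x)\,(\varphi\star g)(x)\,dx-L(g),$$ which is $\mathbb E_G[\hat L]-L(G)$ when $g$ is the density of $G$. For classes $\mathcal G,\widetilde{\mathcal G}$ of such densities put $$\operatorname{ExcessBias}(\hat L,L;\,\mathcal G,\widetilde{\mathcal G})=\sup_{\tilde g\in\widetilde{\mathcal G}}\ \inf_{g\in\mathcal G}\ \bigl|\operatorname{Bias}_g[\hat L,L]-\operatorname{Bias}_{\tilde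 g}[\hat L,L]\bigr| ,$$ a supremum in $[0,\infty]$, equal to $0$ if $\widetilde{\mathcal G}=\emptyset$. **Proposition.** If $b\ge1$, then $$\operatorname{ExcessBias}\bigl(\hat L,L;\ \Pi_p(\mathcal S(b,C_{\mathrm{sob}},C_{\mathrm{herm}})),\ \mathcal S(b,C_{\mathrm{sob}},C_{\mathrm{herm}})\bigr)\longrightarrow0\qquad\text{as }p\to\infty .$$ -/

import Mathlib

open MeasureTheory ProbabilityTheory Filter Topology
open scoped ENNReal Nat

/-- The physicists' Hermite polynomial `H_j(x) = (-1)^j exp(x²) (d/dx)^j exp(-x²)`. -/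
noncomputable def hermitePoly (j : ℕ) (x : ℝ) : ℝ :=
  (-1) ^ j * Real.exp (x ^ 2) * iteratedDeriv j (fun y : ℝ => Real.exp (-y ^ 2)) x

/-- The Hermite function `h_j(x) = c_j H_j(x) exp(-x²/2)`, `c_j = (2^j j! √π)^(-1/2)`. -/
noncomputable def hermiteFun (j : ℕ) (x : ℝ) : ℝ :=
  (√(2 ^ j * (j ! : ℝ) * √Real.pi))⁻¹ * hermitePoly j x * Real.exp (-x ^ 2 / 2)

/-- The coefficient `α_j = ∫ g h_j` of `g` along the `j`-th Hermite function. -/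
noncomputable def hermiteCoeff (g : ℝ → ℝ) (j : ℕ) : ℝ :=
  ∫ x, g x * hermiteFun j x

/-- `Π_p(g) = ∑_{j=0}^p α_j h_j`. It need not be a probability density. -/
noncomputable def hermiteProj (p : ℕ) (g : ℝ → ℝ) (x : ℝ) : ℝ :=
  ∑ j ∈ Finset.range (p + 1), hermiteCoeff g j * hermiteFun j x

/-- `g*(t) = ∫ exp(itμ) g(μ) dμ`. -/
noncomputable def starTransform (g : ℝ → ℝ) (t : ℝ) : ℂ :=
  ∫ μ : ℝ, Complex.exp (Complex.I * t * μ) * (g μ : ℂ)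

/-- The Lebesgue density `g = G'` of an absolutely continuous distribution `G`. -/
noncomputable def lebesgueDensity (G : Measure ℝ) (x : ℝ) : ℝ :=
  (G.rnDeriv volume x).toReal

/-- The Sobolev class `S(b, Csob)`: the distributions with a Lebesgue density `g ∈ L¹ ∩ L²` such
that `∫ |g*(t)|² (t² + 1)^b dt ≤ 2π Csob`. -/
def sobolevClass (b Csob : ℝ) : Set (Measure ℝ) :=
  {G | IsProbabilityMeasure G ∧ G ≪ volume ∧
    MemLp (lebesgueDensity G) 1 volume ∧ MemLp (lebesgueDensity G) 2 volume ∧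
    ∫⁻ t : ℝ, ENNReal.ofReal (‖starTransform (lebesgueDensity G) t‖ ^ 2 * (t ^ 2 + 1) ^ b)
      ≤ ENNReal.ofReal (2 * Real.pi * Csob)}

/-- The Hermite–Sobolev class `S(b, Csob, Cherm)`: those `G ∈ S(b, Csob)` whose density satisfies
`∫ μ² g(μ)² dμ ≤ Cherm`. -/
def hermiteSobolevClass (b Csob Cherm : ℝ) : Set (Measure ℝ) :=
  {G | G ∈ sobolevClass b Csob ∧
    ∫⁻ μ : ℝ, ENNReal.ofReal (μ ^ 2 * lebesgueDensity G μ ^ 2) ≤ ENNReal.ofReal Cherm}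

/-- The linear functional `L(g) = (1/2π) ∫ ψ*(-t) g*(t) dt`; the argument `ψs` is `ψ*`. -/
noncomputable def fourierFunctional (ψs : ℝ → ℂ) (g : ℝ → ℝ) : ℂ :=
  1 / (2 * Real.pi) * ∫ t : ℝ, ψs (-t) * starTransform g t

/-- `(φ ⋆ g)(x) = ∫ φ(x - μ) g(μ) dμ` with `φ` the standard normal density. -/
noncomputable def marginalDensity (g : ℝ → ℝ) (x : ℝ) : ℝ :=
  ∫ μ, gaussianPDFReal 0 1 (x - μ) * g μ

/-- The linear estimator `Q₀ + (1/m) ∑ Q(X_i)`, evaluated at the sample `x`. -/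
noncomputable def linearEstimator (m : ℕ) (Q₀ : ℝ) (Q : ℝ → ℝ) (x : Fin m → ℝ) : ℝ :=
  Q₀ + 1 / (m : ℝ) * ∑ i, Q (x i)

/-- The mean of the linear estimator when the effect sizes have the (possibly signed) density `g`,
so that each observation has the density `φ ⋆ g`; see `integral_linearEstimator`. -/
noncomputable def estimatorMean (m : ℕ) (Q₀ : ℝ) (Q : ℝ → ℝ) (g : ℝ → ℝ) : ℝ :=
  Q₀ + 1 / (m : ℝ) * ∑ _i : Fin m, ∫ x, Q x * marginalDensity g x

/-- The bias at the density `g` of the linear estimator, as an estimator of the functional `L`. -/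
noncomputable def estimatorBias (m : ℕ) (Q₀ : ℝ) (Q : ℝ → ℝ) (L : (ℝ → ℝ) → ℂ) (g : ℝ → ℝ) : ℂ :=
  (estimatorMean m Q₀ Q g : ℂ) - L g

/-- The excess bias `sup_{g' ∈ 𝒢'} inf_{g ∈ 𝒢} |Bias_g - Bias_{g'}|`, for two classes of
(possibly signed) densities. -/
noncomputable def excessBias (m : ℕ) (Q₀ : ℝ) (Q : ℝ → ℝ) (L : (ℝ → ℝ) → ℂ)
    (𝒢 𝒢' : Set (ℝ → ℝ)) : ℝ≥0∞ :=
  ⨆ g' ∈ 𝒢', ⨅ g ∈ 𝒢, ‖estimatorBias m Q₀ Q L g - estimatorBias m Q₀ Q L g'‖ₑ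

theorem integral_marginalDensity (G : Measure ℝ) [IsProbabilityMeasure G] (hG : G ≪ volume)
    (Q : ℝ → ℝ) (hQ : Measurable Q) (C : ℝ) (hC : ∀ x, |Q x| ≤ C) :
    ∫ x, Q x ∂(G ∗ gaussianReal 0 1) = ∫ x, Q x * marginalDensity (lebesgueDensity G) x := by
  have hφ : Integrable (gaussianPDFReal 0 1) volume := integrable_gaussianPDFReal 0 1
  have hg : Integrable (lebesgueDensity G) volume := Measure.integrable_toReal_rnDeriv
  have hbd : ∀ x, ‖Q x‖ ≤ C := hC
  have hint : Integrable (fun z : ℝ × ℝ => Q (z.1 + z.2)) (G.prod (gaussianReal 0 1)) :=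
    Integrable.of_bound (hQ.comp (measurable_fst.add measurable_snd)).aestronglyMeasurable C
      (Eventually.of_forall fun z => hbd _)
  have h1 : ∫ x, Q x ∂(G ∗ gaussianReal 0 1)
      = ∫ μ, ∫ z, Q (μ + z) ∂(gaussianReal 0 1) ∂G := by
    rw [Measure.conv, integral_map (by fun_prop) hQ.aestronglyMeasurable, integral_prod _ hint]
  have h2 : ∀ μ, ∫ z, Q (μ + z) ∂(gaussianReal 0 1)
      = ∫ x, Q x * gaussianPDFReal 0 1 (x - μ) := by
    intro μ
    rw [integral_gaussianReal_eq_integral_smul one_ne_zero,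
      ← integral_sub_right_eq_self _ μ]
    refine integral_congr_ae (Eventually.of_forall fun x => ?_)
    simp [mul_comm]
  have h3 : Integrable (fun z : ℝ × ℝ => gaussianPDFReal 0 1 (z.2 - z.1) * lebesgueDensity G z.1)
      (volume.prod volume) := by
    have h := (measurePreserving_prod_sub (volume : Measure ℝ) (volume : Measure ℝ)).integrable_comp
      (hg.mul_prod hφ).aestronglyMeasurable |>.2 (hg.mul_prod hφ)
    exact h.congr (Eventually.of_forall fun z => mul_comm _ _)
  have h4 : Integrable (fun z : ℝ × ℝ =>
      Q z.2 * (gaussianPDFReal 0 1 (z.2 - z.1) * lebesgueDensity G z.1))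
      (volume.prod volume) :=
    h3.bdd_mul (hQ.comp measurable_snd).aestronglyMeasurable
      (Eventually.of_forall fun z => hbd _)
  calc ∫ x, Q x ∂(G ∗ gaussianReal 0 1)
      = ∫ μ, (∫ x, Q x * gaussianPDFReal 0 1 (x - μ)) ∂G := by rw [h1]; simp only [h2]
    _ = ∫ μ, lebesgueDensity G μ • ∫ x, Q x * gaussianPDFReal 0 1 (x - μ) :=
        (integral_rnDeriv_smul hG).symm
    _ = ∫ μ, ∫ x, Q x * (gaussianPDFReal 0 1 (x - μ) * lebesgueDensity G μ) := by
        refine integral_congr_ae (Eventually.of_forall fun μ => ?_)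
        simp only [smul_eq_mul]
        rw [← integral_const_mul]
        refine integral_congr_ae (Eventually.of_forall fun x => ?_)
        simp only
        ring
    _ = ∫ x, ∫ μ, Q x * (gaussianPDFReal 0 1 (x - μ) * lebesgueDensity G μ) :=
        integral_integral_swap h4
    _ = ∫ x, Q x * marginalDensity (lebesgueDensity G) x := by
        simp only [marginalDensity, integral_const_mul]

theorem integral_linearEstimator {Ω : Type*} [MeasurableSpace Ω] (P : Measure Ω)
    [IsProbabilityMeasure P] (G : Measure ℝ) [IsProbabilityMeasure G] (hG : G ≪ volume)
    (m : ℕ) (Q₀ : ℝ) (Q : ℝ → ℝ) (hQ : Measurable Q) (C : ℝ) (hC : ∀ x, |Q x| ≤ C)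
    (X : Fin m → Ω → ℝ) (hX : ∀ i, Measurable (X i))
    (hlaw : ∀ i, P.map (X i) = G ∗ gaussianReal 0 1) :
    ∫ ω, linearEstimator m Q₀ Q (fun i => X i ω) ∂P
      = estimatorMean m Q₀ Q (lebesgueDensity G) := by
  have hint : ∀ i, Integrable (fun ω => Q (X i ω)) P := fun i =>
    Integrable.of_bound (hQ.comp (hX i)).aestronglyMeasurable C
      (Eventually.of_forall fun ω => hC _)
  have hi : ∀ i, ∫ ω, Q (X i ω) ∂P
      = ∫ x, Q x * marginalDensity (lebesgueDensity G) x := by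
    intro i
    rw [← integral_marginalDensity G hG Q hQ C hC, ← hlaw i,
      integral_map (hX i).aemeasurable hQ.aestronglyMeasurable]
  simp only [linearEstimator, estimatorMean]
  rw [integral_add (integrable_const _) ((integrable_finsetSum _ fun i _ => hint i).const_mul _),
    integral_const_mul, integral_finsetSum _ fun i _ => hint i]
  simp [hi]

/-! For `g` in the large class, compare with its own projection `Π_p g`. The two biases differ by at
most `CQ ‖g - Π_p g‖₁ + Cψ/(2π) ‖g* - (Π_p g)*‖₁`, since convolution with `φ` contracts `L¹`
(`abs_integral_mul_marginalDensity_sub_le`, `norm_fourierFunctional_sub_le`). It remains to bound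
both `L¹` norms by a multiple of `(p+1)^(-1/4)`, uniformly over the class.

The Hermite functions are eigenfunctions of the Fourier transform (`starTransform_hermiteFun`), so
`(Π_p g)* = Π_p(g*)`, and one tail estimate (`integrable_sub_proj_and_integral_norm_le`) serves for
`f = g` and for `f = g*`. It has two inputs: a bound on `∑ (j+1)|c_j|²`, with `c_j` the Hermite
coefficients of `f`, and a bound on `‖x f‖₂`. By Parseval the first gives `‖r‖₂² ≤ K/(p+1)` for the
remainder `r`; together they keep `‖x r‖₂` bounded; and interpolation between these norms controls
`‖r‖₁` (`integrable_and_integral_norm_le`).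

The weighted sum is finite because `x g` and, as `b ≥ 1`, `t g*` lie in `L²`: their Hermite
coefficients are, up to constants, the sum and the difference of the same two neighbouring terms, so
the parallelogram law isolates `(j+1) α_j²` (`sum_mul_hermiteCoeff_sq_le`). Parseval needs
completeness of the Hermite functions, proved through Fourier uniqueness. -/

/-! ### Recurrences and derivatives of the Hermite functions. -/

theorem contDiff_exp_neg_sq : ContDiff ℝ ⊤ (fun y : ℝ => Real.exp (-y ^ 2)) := by fun_prop

theorem hasDerivAt_iteratedDeriv_exp_neg_sq (n : ℕ) (x : ℝ) :
    HasDerivAt (iteratedDeriv n (fun y : ℝ => Real.exp (-y ^ 2)))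
      (iteratedDeriv (n + 1) (fun y : ℝ => Real.exp (-y ^ 2)) x) x := by
  rw [iteratedDeriv_succ]
  refine DifferentiableAt.hasDerivAt ?_
  exact (contDiff_exp_neg_sq.differentiable_iteratedDeriv n (by exact WithTop.coe_lt_top _)) x

theorem iteratedDeriv_one_exp_neg_sq (x : ℝ) :
    iteratedDeriv 1 (fun y : ℝ => Real.exp (-y ^ 2)) x = -2 * x * Real.exp (-x ^ 2) := by
  rw [iteratedDeriv_one]
  have h : HasDerivAt (fun y : ℝ => Real.exp (-y ^ 2)) (Real.exp (-x ^ 2) * (-(2 * x))) x := by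
    simpa using ((hasDerivAt_pow 2 x).neg).exp
  rw [h.deriv]; ring

/-- Leibniz's rule for `(-2y) exp(-y²)`: the factor is linear, so only two terms survive. -/
theorem iteratedDeriv_exp_neg_sq_succ_succ (n : ℕ) (x : ℝ) :
    iteratedDeriv (n + 2) (fun y : ℝ => Real.exp (-y ^ 2)) x
      = -2 * x * iteratedDeriv (n + 1) (fun y : ℝ => Real.exp (-y ^ 2)) x
        - 2 * (n + 1) * iteratedDeriv n (fun y : ℝ => Real.exp (-y ^ 2)) x := by
  induction n generalizing x with
  | zero =>
    rw [iteratedDeriv_succ, zero_add, funext iteratedDeriv_one_exp_neg_sq]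
    have h0 := hasDerivAt_iteratedDeriv_exp_neg_sq 0 x
    simp only [iteratedDeriv_zero, zero_add, iteratedDeriv_one_exp_neg_sq] at h0
    have h := (((hasDerivAt_id x).const_mul (-2 : ℝ)).mul h0).deriv
    simp only [iteratedDeriv_zero]
    refine Eq.trans h ?_
    simp; ring
  | succ n ih =>
    rw [iteratedDeriv_succ, funext ih]
    have h := ((((hasDerivAt_id x).const_mul (-2 : ℝ)).mul
      (hasDerivAt_iteratedDeriv_exp_neg_sq (n + 1) x)).sub
      ((hasDerivAt_iteratedDeriv_exp_neg_sq n x).const_mul (2 * ((n : ℝ) + 1)))).deriv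
    refine Eq.trans h ?_
    simp [ih]; ring

theorem hermitePoly_zero (x : ℝ) : hermitePoly 0 x = 1 := by
  simp [hermitePoly, ← Real.exp_add]

theorem hermitePoly_one (x : ℝ) : hermitePoly 1 x = 2 * x := by
  have h : Real.exp (x ^ 2) * Real.exp (-x ^ 2) = 1 := by simp [← Real.exp_add]
  rw [hermitePoly, iteratedDeriv_one_exp_neg_sq]
  linear_combination (2 * x) * h

theorem hermitePoly_succ_succ (n : ℕ) (x : ℝ) :
    hermitePoly (n + 2) x = 2 * x * hermitePoly (n + 1) x - 2 * (n + 1) * hermitePoly n x := by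
  simp only [hermitePoly, iteratedDeriv_exp_neg_sq_succ_succ]
  ring

theorem hasDerivAt_hermitePoly (n : ℕ) (x : ℝ) :
    HasDerivAt (hermitePoly n) (2 * x * hermitePoly n x - hermitePoly (n + 1) x) x := by
  have h1 : HasDerivAt (fun y : ℝ => (-1 : ℝ) ^ n * Real.exp (y ^ 2))
      ((-1) ^ n * (Real.exp (x ^ 2) * (2 * x))) x := by
    simpa using ((hasDerivAt_pow 2 x).exp).const_mul ((-1 : ℝ) ^ n)
  refine (h1.mul (hasDerivAt_iteratedDeriv_exp_neg_sq n x)).congr_deriv ?_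
  simp only [hermitePoly]
  ring

theorem sqrt_hermite_normalization (n : ℕ) :
    √(2 * ((n + 1 : ℕ) : ℝ)) * (√(2 ^ (n + 1) * ((n + 1)! : ℝ) * √Real.pi))⁻¹
      = (√(2 ^ n * (n ! : ℝ) * √Real.pi))⁻¹ := by
  have h : (2 : ℝ) ^ (n + 1) * ((n + 1)! : ℝ) * √Real.pi
      = (2 * ((n + 1 : ℕ) : ℝ)) * (2 ^ n * (n ! : ℝ) * √Real.pi) := by
    rw [Nat.factorial_succ]; push_cast; ring
  rw [h, Real.sqrt_mul (x := 2 * ((n + 1 : ℕ) : ℝ)) (by positivity), mul_inv, ← mul_assoc, mul_inv_cancel₀, one_mul]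
  positivity

theorem sqrt_mul_hermiteFun_succ (n : ℕ) (x : ℝ) :
    √(2 * ((n + 1 : ℕ) : ℝ)) * hermiteFun (n + 1) x
      = (√(2 ^ n * (n ! : ℝ) * √Real.pi))⁻¹ * hermitePoly (n + 1) x * Real.exp (-x ^ 2 / 2) := by
  rw [hermiteFun, ← sqrt_hermite_normalization n]; ring

/-- The three-term recurrence of the Hermite functions. -/
theorem two_mul_mul_hermiteFun (n : ℕ) (x : ℝ) :
    2 * (x * hermiteFun n x)
      = √(2 * ((n + 1 : ℕ) : ℝ)) * hermiteFun (n + 1) x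
        + √(2 * (n : ℝ)) * hermiteFun (n - 1) x := by
  rw [sqrt_mul_hermiteFun_succ]
  cases n with
  -- Here `n - 1` truncates to `0`, which is harmless because its coefficient is `√0`.
  | zero => simp [hermiteFun, hermitePoly_zero, hermitePoly_one]; ring
  | succ n =>
    have hs : √(2 * ((n + 1 : ℕ) : ℝ)) * √(2 * ((n + 1 : ℕ) : ℝ)) = 2 * (n + 1) := by
      rw [Real.mul_self_sqrt (by positivity)]; push_cast; ring
    simp only [Nat.add_sub_cancel, hermiteFun]
    rw [hermitePoly_succ_succ, ← sqrt_hermite_normalization n]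
    linear_combination (-(√(2 ^ (n + 1) * ((n + 1)! : ℝ) * √Real.pi))⁻¹ * hermitePoly n x
      * Real.exp (-x ^ 2 / 2)) * hs

/-- Written so that the raising operator `x - d/dx` can be read off; it drives both orthonormality
and the Fourier eigenvalues. -/
theorem hasDerivAt_hermiteFun (n : ℕ) (x : ℝ) :
    HasDerivAt (hermiteFun n)
      (x * hermiteFun n x - √(2 * ((n + 1 : ℕ) : ℝ)) * hermiteFun (n + 1) x) x := by
  rw [sqrt_mul_hermiteFun_succ]
  have h1 : HasDerivAt (fun y : ℝ => Real.exp (-y ^ 2 / 2)) (Real.exp (-x ^ 2 / 2) * (-x)) x := by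
    refine (((hasDerivAt_pow 2 x).neg.div_const 2).exp).congr_deriv ?_
    simp
    ring
  refine (((hasDerivAt_hermitePoly n x).const_mul _).mul h1).congr_deriv ?_
  simp only [hermiteFun]
  ring

/-! ### Integrability: polynomials times Gaussians. -/

theorem hermiteFun_eq_polynomial_mul_exp (n : ℕ) :
    ∃ P : Polynomial ℝ, ∀ x, hermiteFun n x = P.eval x * Real.exp (-(1 / 2) * x ^ 2) := by
  suffices h : ∃ P : Polynomial ℝ, ∀ x, hermitePoly n x = P.eval x by
    obtain ⟨P, hP⟩ := h
    refine ⟨Polynomial.C (√(2 ^ n * (n ! : ℝ) * √Real.pi))⁻¹ * P, fun x => ?_⟩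
    rw [hermiteFun, hP, Polynomial.eval_mul, Polynomial.eval_C]
    congr 2; ring
  induction n using Nat.twoStepInduction with
  | zero => exact ⟨1, fun x => by simp [hermitePoly_zero]⟩
  | one => exact ⟨Polynomial.C 2 * Polynomial.X, fun x => by simp [hermitePoly_one]⟩
  | more n h0 h1 =>
    obtain ⟨P, hP⟩ := h0
    obtain ⟨R, hR⟩ := h1
    refine ⟨Polynomial.C 2 * Polynomial.X * R - Polynomial.C (2 * ((n : ℝ) + 1)) * P, fun x => ?_⟩
    rw [hermitePoly_succ_succ, hP, hR]
    simp

theorem integrable_polynomial_mul_exp_neg_mul_sq (P : Polynomial ℝ) {b : ℝ} (hb : 0 < b) :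
    Integrable fun x : ℝ => P.eval x * Real.exp (-b * x ^ 2) := by
  induction P using Polynomial.induction_on' with
  | add p q hp hq =>
    refine (hp.add hq).congr (Eventually.of_forall fun x => ?_)
    simp [add_mul]
  | monomial n a =>
    have h := (integrable_rpow_mul_exp_neg_mul_sq hb (s := (n : ℝ))
      (lt_of_lt_of_le (by norm_num) n.cast_nonneg)).const_mul a
    refine h.congr (Eventually.of_forall fun x => ?_)
    simp [Real.rpow_natCast, mul_assoc]

theorem continuous_hermiteFun (n : ℕ) : Continuous (hermiteFun n) :=
  continuous_iff_continuousAt.2 fun x => (hasDerivAt_hermiteFun n x).continuousAt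

theorem integrable_pow_mul_hermiteFun (k n : ℕ) : Integrable fun x => x ^ k * hermiteFun n x := by
  obtain ⟨P, hP⟩ := hermiteFun_eq_polynomial_mul_exp n
  refine (integrable_polynomial_mul_exp_neg_mul_sq (Polynomial.X ^ k * P)
    (b := 1 / 2) (by norm_num)).congr (Eventually.of_forall fun x => ?_)
  simp [hP, mul_assoc]

theorem integrable_hermiteFun (n : ℕ) : Integrable (hermiteFun n) := by
  simpa using integrable_pow_mul_hermiteFun 0 n

theorem memLp_two_pow_mul_hermiteFun (k n : ℕ) :
    MemLp (fun x => x ^ k * hermiteFun n x) 2 volume := by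
  obtain ⟨P, hP⟩ := hermiteFun_eq_polynomial_mul_exp n
  have hc := continuous_hermiteFun n
  rw [memLp_two_iff_integrable_sq (by fun_prop)]
  refine (integrable_polynomial_mul_exp_neg_mul_sq ((Polynomial.X ^ k * P) ^ 2)
    (b := 1) (by norm_num)).congr (Eventually.of_forall fun x => ?_)
  have h : Real.exp (-1 * x ^ 2) = Real.exp (-(1 / 2) * x ^ 2) ^ 2 := by
    rw [← Real.exp_nat_mul]; congr 1; push_cast; ring
  simp only [hP, Polynomial.eval_pow, Polynomial.eval_mul, Polynomial.eval_X]
  rw [h]; ring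

theorem memLp_two_hermiteFun (n : ℕ) : MemLp (hermiteFun n) 2 volume := by
  simpa using memLp_two_pow_mul_hermiteFun 0 n

/-! ### Orthonormality. -/

theorem integrable_hermiteFun_mul_hermiteFun (j k : ℕ) :
    Integrable fun x => hermiteFun j x * hermiteFun k x :=
  (memLp_two_hermiteFun j).integrable_mul (memLp_two_hermiteFun k)

theorem memLp_two_mul_hermiteFun (n : ℕ) : MemLp (fun x => x * hermiteFun n x) 2 volume := by
  simpa using memLp_two_pow_mul_hermiteFun 1 n

/-- The lowering operator `x + d/dx` on the Hermite functions. -/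
theorem mul_add_deriv_hermiteFun (n : ℕ) (x : ℝ) :
    x * hermiteFun n x + (x * hermiteFun n x - √(2 * ((n + 1 : ℕ) : ℝ)) * hermiteFun (n + 1) x)
      = √(2 * (n : ℝ)) * hermiteFun (n - 1) x := by
  linear_combination two_mul_mul_hermiteFun n x

/-- Integration by parts makes `x - d/dx` and `x + d/dx` adjoint to each other. Both indices drop by
one, and for `j = 0` the factor `√0` kills the right side, so orthonormality follows by induction.
-/
theorem integral_hermiteFun_mul_succ (j k : ℕ) :
    √(2 * ((k + 1 : ℕ) : ℝ)) * ∫ x, hermiteFun j x * hermiteFun (k + 1) x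
      = √(2 * (j : ℝ)) * ∫ x, hermiteFun (j - 1) x * hermiteFun k x := by
  have hd (n : ℕ) : MemLp (fun x => x * hermiteFun n x
      - √(2 * ((n + 1 : ℕ) : ℝ)) * hermiteFun (n + 1) x) 2 volume :=
    (memLp_two_mul_hermiteFun n).sub ((memLp_two_hermiteFun (n + 1)).const_mul _)
  have i1 : Integrable (fun x => hermiteFun j x * (x * hermiteFun k x
      - √(2 * ((k + 1 : ℕ) : ℝ)) * hermiteFun (k + 1) x)) := (memLp_two_hermiteFun j).integrable_mul (hd k)
  have i2 : Integrable (fun x => (x * hermiteFun j x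
      - √(2 * ((j + 1 : ℕ) : ℝ)) * hermiteFun (j + 1) x) * hermiteFun k x) := (hd j).integrable_mul (memLp_two_hermiteFun k)
  have i3 : Integrable (fun x => hermiteFun j x * (x * hermiteFun k x)) :=
    (memLp_two_hermiteFun j).integrable_mul (memLp_two_mul_hermiteFun k)
  have hparts := integral_mul_deriv_eq_deriv_mul_of_integrable
    (fun x _ => hasDerivAt_hermiteFun j x) (fun x _ => hasDerivAt_hermiteFun k x) i1 i2
    (integrable_hermiteFun_mul_hermiteFun j k)
  have e1 : √(2 * ((k + 1 : ℕ) : ℝ)) * ∫ x, hermiteFun j x * hermiteFun (k + 1) x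
      = (∫ x, hermiteFun j x * (x * hermiteFun k x))
        - ∫ x, hermiteFun j x * (x * hermiteFun k x
          - √(2 * ((k + 1 : ℕ) : ℝ)) * hermiteFun (k + 1) x) := by
    rw [← integral_sub i3 i1, ← integral_const_mul]
    congr 1; ext x; ring
  have e2 : √(2 * (j : ℝ)) * ∫ x, hermiteFun (j - 1) x * hermiteFun k x
      = (∫ x, hermiteFun j x * (x * hermiteFun k x))
        + ∫ x, (x * hermiteFun j x - √(2 * ((j + 1 : ℕ) : ℝ)) * hermiteFun (j + 1) x)
          * hermiteFun k x := by
    rw [← integral_add i3 i2, ← integral_const_mul]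
    congr 1; ext x
    linear_combination (-hermiteFun k x) * mul_add_deriv_hermiteFun j x
  rw [e1, e2, hparts]; ring

theorem integral_hermiteFun_zero_mul_self : ∫ x, hermiteFun 0 x * hermiteFun 0 x = 1 := by
  have h : ∀ x, hermiteFun 0 x * hermiteFun 0 x = (√Real.pi)⁻¹ * Real.exp (-1 * x ^ 2) := by
    intro x
    have h1 : Real.exp (-1 * x ^ 2) = Real.exp (-x ^ 2 / 2) * Real.exp (-x ^ 2 / 2) := by
      rw [← Real.exp_add]; congr 1; ring
    have h2 : (√√Real.pi)⁻¹ * (√√Real.pi)⁻¹ = (√Real.pi)⁻¹ := by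
      rw [← mul_inv, Real.mul_self_sqrt (Real.sqrt_nonneg _)]
    simp only [hermiteFun, hermitePoly_zero, pow_zero, Nat.factorial_zero, Nat.cast_one, one_mul,
      mul_one]
    rw [h1, ← h2]; ring
  simp only [h]
  rw [integral_const_mul, integral_gaussian]
  simp only [div_one]
  exact inv_mul_cancel₀ (by positivity)

/-- The Hermite functions are orthonormal. -/
theorem integral_hermiteFun_mul_hermiteFun (j k : ℕ) :
    ∫ x, hermiteFun j x * hermiteFun k x = if j = k then 1 else 0 := by
  have hs (n : ℕ) : √(2 * ((n + 1 : ℕ) : ℝ)) ≠ 0 := by positivity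
  have hz (k : ℕ) : ∫ x, hermiteFun 0 x * hermiteFun (k + 1) x = 0 := by
    have h := integral_hermiteFun_mul_succ 0 k
    simp only [Nat.cast_zero, mul_zero, Real.sqrt_zero, zero_mul] at h
    exact (mul_eq_zero.1 h).resolve_left (hs k)
  induction k generalizing j with
  | zero =>
    cases j with
    | zero => simpa using integral_hermiteFun_zero_mul_self
    | succ j => simpa [mul_comm] using hz j
  | succ k ih =>
    cases j with
    | zero => simpa using hz k
    | succ j =>
      have h := integral_hermiteFun_mul_succ (j + 1) k
      rw [Nat.add_sub_cancel, ih] at h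
      by_cases hjk : j = k
      · subst hjk
        simpa using mul_left_cancel₀ (hs j) h
      · rw [if_neg hjk, mul_zero] at h
        simpa [hjk] using (mul_eq_zero.1 h).resolve_left (hs k)

/-! ### Fourier uniqueness and completeness in `L²`. -/

/-- An integrable function whose Fourier transform vanishes is zero almost everywhere. -/
theorem ae_eq_zero_of_integral_cexp_mul_eq_zero {F : ℝ → ℂ} (hF : Integrable F)
    (h : ∀ t : ℝ, ∫ x : ℝ, Complex.exp (Complex.I * t * x) * F x = 0) : ∀ᵐ x, F x = 0 := by
  have hft : FourierTransform.fourier F = 0 := by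
    ext w
    -- The two Fourier conventions differ by the change of frequency `t = -2πw`.
    rw [Real.fourier_real_eq_integral_exp_smul, Pi.zero_apply, ← h (-2 * Real.pi * w)]
    congr 1; ext x
    rw [smul_eq_mul]
    congr 2; push_cast; ring
  refine ae_eq_zero_of_integral_contDiff_smul_eq_zero hF.locallyIntegrable fun g hg hgs => ?_
  have hgs' : HasCompactSupport (fun x => (g x : ℂ)) := hgs.comp_left Complex.ofReal_zero
  -- The test function is itself the Fourier transform of a Schwartz function `v`, so its pairing
  -- with `F` equals the pairing of `v` with the transform of `F`, which is zero.
  let w : SchwartzMap ℝ ℂ := hgs'.toSchwartzMap (Complex.ofRealCLM.contDiff.comp hg)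
  let v : SchwartzMap ℝ ℂ := FourierTransformInv.fourierInv w
  have hw : FourierTransform.fourier (v : ℝ → ℂ) = w := by
    rw [← SchwartzMap.fourier_coe]
    exact congrArg DFunLike.coe (FourierTransform.fourier_fourierInv_eq w)
  have hp := VectorFourier.integral_fourierIntegral_smul_eq_flip (L := innerₗ ℝ)
    (μ := (volume : Measure ℝ)) (ν := (volume : Measure ℝ)) (f := (v : ℝ → ℂ)) (g := F)
    Real.continuous_fourierChar continuous_inner v.integrable hF
  rw [flip_innerₗ] at hp
  change ∫ ξ, FourierTransform.fourier (v : ℝ → ℂ) ξ • F ξ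
    = ∫ x, v x • FourierTransform.fourier F x at hp
  rw [hw, hft] at hp
  have hw0 : ∀ x, w x = (g x : ℂ) := fun x => rfl
  simpa [hw0] using hp

theorem hermiteFun_zero (x : ℝ) :
    hermiteFun 0 x = (√√Real.pi)⁻¹ * Real.exp (-x ^ 2 / 2) := by
  simp [hermiteFun, hermitePoly_zero]

theorem hermiteFun_zero_pos (x : ℝ) : 0 < hermiteFun 0 x := by
  rw [hermiteFun_zero]; positivity

/-- By `|tx| ≤ t² + x²/4`, half of the Gaussian exponent survives. This dominates the Taylor sums of
`exp(itx)` in the completeness proof. -/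
theorem exp_abs_mul_hermiteFun_zero_le (t x : ℝ) :
    Real.exp |t * x| * hermiteFun 0 x
      ≤ (√√Real.pi)⁻¹ * Real.exp (t ^ 2) * Real.exp (-(1 / 4) * x ^ 2) := by
  rw [hermiteFun_zero, mul_assoc, ← Real.exp_add, mul_left_comm, ← Real.exp_add]
  refine mul_le_mul_of_nonneg_left (Real.exp_le_exp.2 ?_) (by positivity)
  have h1 : |t * x| = |t| * |x| := abs_mul t x
  have h2 := sq_nonneg (|t| - |x| / 2)
  have h3 := sq_abs t
  have h4 := sq_abs x
  nlinarith

theorem memLp_two_exp_neg_mul_sq {b : ℝ} (hb : 0 < b) :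
    MemLp (fun x : ℝ => Real.exp (-b * x ^ 2)) 2 volume := by
  rw [memLp_two_iff_integrable_sq (by fun_prop)]
  refine (integrable_exp_neg_mul_sq (b := 2 * b) (by positivity)).congr
    (Eventually.of_forall fun x => ?_)
  simp only
  rw [← Real.exp_nat_mul]; congr 1; push_cast; ring

theorem integrable_mul_pow_mul_hermiteFun {f : ℝ → ℂ} (hf : MemLp f 2 volume) (k n : ℕ) :
    Integrable fun x => f x * ((x ^ k * hermiteFun n x : ℝ) : ℂ) :=
  hf.integrable_mul (memLp_two_pow_mul_hermiteFun k n).ofReal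

theorem integrable_mul_hermiteFun {f : ℝ → ℂ} (hf : MemLp f 2 volume) (n : ℕ) :
    Integrable fun x => f x * (hermiteFun n x : ℂ) :=
  hf.integrable_mul (memLp_two_hermiteFun n).ofReal

/-- The three-term recurrence trades a factor `x` for the neighbouring indices. With `n = 0` this
annihilates every Taylor term of `exp(itx)` against `f h_0`. -/
theorem integral_mul_pow_mul_hermiteFun_eq_zero {f : ℝ → ℂ} (hf : MemLp f 2 volume)
    (h : ∀ j, ∫ x, f x * (hermiteFun j x : ℂ) = 0) (k n : ℕ) :
    ∫ x, f x * ((x ^ k * hermiteFun n x : ℝ) : ℂ) = 0 := by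
  induction k generalizing n with
  | zero => simpa using h n
  | succ k ih =>
    have e : ∀ x, f x * ((x ^ (k + 1) * hermiteFun n x : ℝ) : ℂ)
        = ((√(2 * ((n + 1 : ℕ) : ℝ)) / 2 : ℝ) : ℂ)
            * (f x * ((x ^ k * hermiteFun (n + 1) x : ℝ) : ℂ))
          + ((√(2 * (n : ℝ)) / 2 : ℝ) : ℂ) * (f x * ((x ^ k * hermiteFun (n - 1) x : ℝ) : ℂ)) := by
      intro x
      have hr : x ^ (k + 1) * hermiteFun n x
          = √(2 * ((n + 1 : ℕ) : ℝ)) / 2 * (x ^ k * hermiteFun (n + 1) x)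
            + √(2 * (n : ℝ)) / 2 * (x ^ k * hermiteFun (n - 1) x) := by
        linear_combination (x ^ k / 2) * two_mul_mul_hermiteFun n x
      rw [hr]; push_cast; ring
    simp only [e]
    rw [integral_add ((integrable_mul_pow_mul_hermiteFun hf k _).const_mul _)
      ((integrable_mul_pow_mul_hermiteFun hf k _).const_mul _), integral_const_mul,
      integral_const_mul, ih, ih]
    simp

/-- The Hermite functions are complete in `L²`. -/
theorem ae_eq_zero_of_integral_mul_hermiteFun_eq_zero {f : ℝ → ℂ} (hf : MemLp f 2 volume)
    (h : ∀ j, ∫ x, f x * (hermiteFun j x : ℂ) = 0) : ∀ᵐ x, f x = 0 := by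
  have hF := integrable_mul_hermiteFun hf 0
  -- `h_0` never vanishes, and `f h_0` is integrable, so Fourier uniqueness applies to it.
  suffices hz : ∀ᵐ x, f x * (hermiteFun 0 x : ℂ) = 0 by
    filter_upwards [hz] with x hx
    exact (mul_eq_zero.1 hx).resolve_right
      (Complex.ofReal_ne_zero.2 (hermiteFun_zero_pos x).ne')
  refine ae_eq_zero_of_integral_cexp_mul_eq_zero hF fun t => ?_
  let S : ℕ → ℝ → ℂ := fun N x =>
    (∑ n ∈ Finset.range N, (Complex.I * t * x) ^ n / (n ! : ℂ)) * (f x * (hermiteFun 0 x : ℂ))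
  have hS : ∀ N, ∫ x, S N x = 0 := by
    intro N
    have e : ∀ x, S N x = ∑ n ∈ Finset.range N, ((Complex.I * t) ^ n / (n ! : ℂ))
        * (f x * ((x ^ n * hermiteFun 0 x : ℝ) : ℂ)) := by
      intro x
      simp only [S, Finset.sum_mul]
      refine Finset.sum_congr rfl fun n _ => ?_
      push_cast; ring
    simp only [e]
    rw [integral_finsetSum _ fun n _ => (integrable_mul_pow_mul_hermiteFun hf n 0).const_mul _]
    refine Finset.sum_eq_zero fun n _ => ?_
    rw [integral_const_mul, integral_mul_pow_mul_hermiteFun_eq_zero hf h, mul_zero]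
  have hlim : Tendsto (fun N => ∫ x, S N x) atTop
      (𝓝 (∫ x : ℝ, Complex.exp (Complex.I * t * x) * (f x * (hermiteFun 0 x : ℂ)))) := by
    refine tendsto_integral_of_dominated_convergence
      (fun x => ‖f x‖ * ((√√Real.pi)⁻¹ * Real.exp (t ^ 2) * Real.exp (-(1 / 4) * x ^ 2)))
      (fun N => ?_) ?_ (fun N => Eventually.of_forall fun x => ?_)
      (Eventually.of_forall fun x => ?_)
    · exact (Continuous.aestronglyMeasurable (by fun_prop)).mul hF.aestronglyMeasurable
    · exact hf.norm.integrable_mul ((memLp_two_exp_neg_mul_sq (by norm_num)).const_mul _)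
    · have h1 : ‖∑ n ∈ Finset.range N, (Complex.I * t * x) ^ n / (n ! : ℂ)‖
          ≤ Real.exp |t * x| := by
        refine (norm_sum_le _ _).trans (le_trans (le_of_eq ?_)
          (Real.sum_le_exp_of_nonneg (abs_nonneg (t * x)) N))
        refine Finset.sum_congr rfl fun n _ => ?_
        simp [abs_mul]
      have h2 : ‖(hermiteFun 0 x : ℂ)‖ = hermiteFun 0 x := by
        rw [Complex.norm_real, Real.norm_of_nonneg (hermiteFun_zero_pos x).le]
      calc ‖S N x‖ = ‖∑ n ∈ Finset.range N, (Complex.I * t * x) ^ n / (n ! : ℂ)‖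
            * (‖f x‖ * hermiteFun 0 x) := by rw [norm_mul, norm_mul, h2]
        _ ≤ Real.exp |t * x| * (‖f x‖ * hermiteFun 0 x) := by
          have := (hermiteFun_zero_pos x).le
          gcongr
        _ = ‖f x‖ * (Real.exp |t * x| * hermiteFun 0 x) := by ring
        _ ≤ _ := mul_le_mul_of_nonneg_left (exp_abs_mul_hermiteFun_zero_le t x) (norm_nonneg _)
    · have he := (NormedSpace.expSeries_div_hasSum_exp (Complex.I * t * x)).tendsto_sum_nat
      rw [← Complex.exp_eq_exp_ℂ] at he
      exact he.mul_const _
  simp only [hS] at hlim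
  exact tendsto_nhds_unique hlim tendsto_const_nhds

/-! ### The Fourier transform of the Hermite functions. -/

theorem norm_cexp_I_mul_mul (t x : ℝ) : ‖Complex.exp (Complex.I * t * x)‖ = 1 := by
  have h : Complex.I * t * x = ((t * x : ℝ) : ℂ) * Complex.I := by push_cast; ring
  rw [h, Complex.norm_exp_ofReal_mul_I]

theorem integrable_cexp_mul {F : ℝ → ℂ} (hF : Integrable F) (t : ℝ) :
    Integrable fun x : ℝ => Complex.exp (Complex.I * t * x) * F x :=
  hF.bdd_mul (c := 1) (Continuous.aestronglyMeasurable (by fun_prop))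
    (Eventually.of_forall fun x => (norm_cexp_I_mul_mul t x).le)

/-- Fubini. With `h = h_j` it yields the Hermite coefficients of `g*` from integrability of `g`
alone, without Plancherel. -/
theorem integral_starTransform_mul {g h : ℝ → ℝ} (hg : Integrable g) (hh : Integrable h) :
    ∫ t, starTransform g t * (h t : ℂ) = ∫ x, (g x : ℂ) * starTransform h x := by
  have hi : Integrable (fun z : ℝ × ℝ =>
      Complex.exp (Complex.I * z.1 * z.2) * ((h z.1 : ℂ) * (g z.2 : ℂ))) (volume.prod volume) :=
    (hh.ofReal.mul_prod hg.ofReal).bdd_mul (c := 1)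
      (Continuous.aestronglyMeasurable (by fun_prop))
      (Eventually.of_forall fun z => (norm_cexp_I_mul_mul z.1 z.2).le)
  calc ∫ t, starTransform g t * (h t : ℂ)
      = ∫ t : ℝ, ∫ x : ℝ, Complex.exp (Complex.I * t * x) * ((h t : ℂ) * (g x : ℂ)) := by
        congr 1; ext t
        rw [starTransform, ← integral_mul_const]
        congr 1; ext x; ring
    _ = ∫ x : ℝ, ∫ t : ℝ, Complex.exp (Complex.I * t * x) * ((h t : ℂ) * (g x : ℂ)) :=
        integral_integral_swap hi
    _ = ∫ x, (g x : ℂ) * starTransform h x := by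
        congr 1; ext x
        rw [starTransform, ← integral_const_mul]
        congr 1; ext t
        rw [mul_right_comm Complex.I]; ring

theorem starTransform_deriv {h h' : ℝ → ℝ} (hd : ∀ x, HasDerivAt h (h' x) x)
    (hi : Integrable h) (hi' : Integrable h') (t : ℝ) :
    starTransform h' t = -(Complex.I * t) * starTransform h t := by
  have hu (x : ℝ) : HasDerivAt (fun x : ℝ => Complex.exp (Complex.I * t * x))
      (Complex.I * t * Complex.exp (Complex.I * t * x)) x := by
    have h1 : HasDerivAt (fun x : ℝ => Complex.I * t * (x : ℂ)) (Complex.I * t) x := by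
      simpa using (Complex.ofRealCLM.hasDerivAt (x := x)).const_mul (Complex.I * t)
    exact h1.cexp.congr_deriv (mul_comm _ _)
  have hp := integral_mul_deriv_eq_deriv_mul_of_integrable
    (fun x _ => hu x) (fun x _ => (hd x).ofReal_comp)
    (integrable_cexp_mul hi'.ofReal t)
    (by
      refine ((integrable_cexp_mul hi.ofReal t).const_mul (Complex.I * t)).congr
        (Eventually.of_forall fun x => ?_)
      simp [mul_assoc])
    (integrable_cexp_mul hi.ofReal t)
  rw [starTransform, hp, starTransform, ← integral_const_mul, ← integral_neg]
  congr 1; ext x; ring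

theorem hasDerivAt_starTransform {h : ℝ → ℝ} (hi : Integrable h)
    (hi' : Integrable fun x => x * h x) (t : ℝ) :
    HasDerivAt (starTransform h) (Complex.I * starTransform (fun x => x * h x) t) t := by
  have hd := hasDerivAt_integral_of_dominated_loc_of_deriv_le (𝕜 := ℝ) (μ := volume)
    (F := fun (t : ℝ) (x : ℝ) => Complex.exp (Complex.I * t * x) * (h x : ℂ))
    (F' := fun (t : ℝ) (x : ℝ) =>
      Complex.I * (Complex.exp (Complex.I * t * x) * ((x * h x : ℝ) : ℂ)))
    (bound := fun x => ‖x * h x‖) (x₀ := t) univ_mem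
    (Eventually.of_forall fun s => (integrable_cexp_mul hi.ofReal s).aestronglyMeasurable)
    (integrable_cexp_mul hi.ofReal t)
    ((integrable_cexp_mul hi'.ofReal t).const_mul _).aestronglyMeasurable
    (Eventually.of_forall fun x s _ => by
      rw [norm_mul, norm_mul, norm_cexp_I_mul_mul, Complex.norm_I, Complex.norm_real, one_mul,
        one_mul])
    hi'.norm
    (Eventually.of_forall fun x s _ => by
      have h1 : HasDerivAt (fun s : ℝ => Complex.I * (s : ℂ) * x) (Complex.I * x) s := by
        simpa using ((Complex.ofRealCLM.hasDerivAt (x := s)).const_mul Complex.I).mul_const (x : ℂ)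
      refine (h1.cexp.mul_const (h x : ℂ)).congr_deriv ?_
      push_cast; ring)
  refine hd.2.congr_deriv ?_
  rw [integral_const_mul]
  rfl

/-- The Hermite functions are eigenfunctions of the Fourier transform. -/
theorem starTransform_hermiteFun (n : ℕ) (t : ℝ) :
    starTransform (hermiteFun n) t
      = (√(2 * Real.pi) : ℝ) * Complex.I ^ n * (hermiteFun n t : ℂ) := by
  induction n generalizing t with
  | zero =>
    have e : ∀ x : ℝ, Complex.exp (Complex.I * t * x) * (hermiteFun 0 x : ℂ)
        = ((√√Real.pi)⁻¹ : ℝ) * (Complex.exp (Complex.I * t * x)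
          * Complex.exp (-(1 / 2 : ℂ) * x ^ 2)) := by
      intro x
      rw [hermiteFun_zero]
      push_cast
      rw [show -(x : ℂ) ^ 2 / 2 = -(1 / 2 : ℂ) * x ^ 2 by ring]
      ring
    have hs : ((Real.pi : ℂ) / (1 / 2)) ^ (1 / 2 : ℂ) = (√(2 * Real.pi) : ℝ) := by
      rw [Real.sqrt_eq_rpow, Complex.ofReal_cpow (by positivity)]
      congr 1 <;> push_cast <;> ring
    simp only [starTransform, e]
    rw [integral_const_mul, fourierIntegral_gaussian (by norm_num), hs, hermiteFun_zero]
    push_cast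
    rw [show -(t : ℂ) ^ 2 / (4 * (1 / 2)) = -(t : ℂ) ^ 2 / 2 by ring]
    ring
  -- `√(2(n+1)) h_{n+1} = (x - d/dx) h_n`. The transform turns `x` into `-i d/dt` and `d/dx` into
  -- `-it`, hence `x - d/dx` into `i(t - d/dt)`: each raising contributes one factor `i`.
  | succ n ih =>
    have hi := integrable_hermiteFun n
    have hxi : Integrable fun x => x * hermiteFun n x := by
      simpa using integrable_pow_mul_hermiteFun 1 n
    have hdi : Integrable fun x => x * hermiteFun n x
        - √(2 * ((n + 1 : ℕ) : ℝ)) * hermiteFun (n + 1) x :=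
      hxi.sub ((integrable_hermiteFun (n + 1)).const_mul _)
    have h1 := starTransform_deriv (hasDerivAt_hermiteFun n) hi hdi t
    have h2 : Complex.I * starTransform (fun x => x * hermiteFun n x) t
        = (√(2 * Real.pi) : ℝ) * Complex.I ^ n * ((t * hermiteFun n t
          - √(2 * ((n + 1 : ℕ) : ℝ)) * hermiteFun (n + 1) t : ℝ) : ℂ) := by
      have hd := hasDerivAt_starTransform hi hxi t
      rw [funext ih] at hd
      exact hd.unique ((hasDerivAt_hermiteFun n t).ofReal_comp.const_mul _)
    have h3 : starTransform (fun x => x * hermiteFun n x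
        - √(2 * ((n + 1 : ℕ) : ℝ)) * hermiteFun (n + 1) x) t
        = starTransform (fun x => x * hermiteFun n x) t
          - (√(2 * ((n + 1 : ℕ) : ℝ)) : ℝ) * starTransform (hermiteFun (n + 1)) t := by
      have i1 : Integrable fun x : ℝ =>
          Complex.exp (Complex.I * t * x) * ((x * hermiteFun n x : ℝ) : ℂ) :=
        integrable_cexp_mul hxi.ofReal t
      have i2 : Integrable fun x : ℝ => ((√(2 * ((n + 1 : ℕ) : ℝ)) : ℝ) : ℂ)
          * (Complex.exp (Complex.I * t * x) * (hermiteFun (n + 1) x : ℂ)) :=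
        (integrable_cexp_mul (integrable_hermiteFun (n + 1)).ofReal t).const_mul _
      simp only [starTransform]
      rw [← integral_const_mul, ← integral_sub i1 i2]
      congr 1; ext x; push_cast; ring
    have hs : ((√(2 * ((n + 1 : ℕ) : ℝ)) : ℝ) : ℂ) ≠ 0 :=
      Complex.ofReal_ne_zero.2 (by positivity)
    refine mul_left_cancel₀ hs ?_
    rw [h3, ih] at h1
    push_cast at h1 h2 ⊢
    rw [pow_succ]
    linear_combination (-1 : ℂ) * h1 - Complex.I * h2
      + starTransform (fun x => x * hermiteFun n x) t * Complex.I_sq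

/-! ### Hermite expansions in complex `L²`. -/

/-- The coefficient of a complex-valued function along the `j`-th Hermite function. -/
noncomputable def complexHermiteCoeff (f : ℝ → ℂ) (j : ℕ) : ℂ :=
  ∫ x, f x * (hermiteFun j x : ℂ)

/-- The projection of a complex-valued function onto the first `p + 1` Hermite functions. -/
noncomputable def complexHermiteProj (p : ℕ) (f : ℝ → ℂ) (x : ℝ) : ℂ :=
  ∑ j ∈ Finset.range (p + 1), complexHermiteCoeff f j * (hermiteFun j x : ℂ)

theorem memLp_two_ofReal_hermiteFun (n : ℕ) :
    MemLp (fun x => (hermiteFun n x : ℂ)) 2 volume :=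
  (memLp_two_hermiteFun n).ofReal

/-- The `n`-th Hermite function as an element of `L²`. -/
noncomputable def hermiteLp (n : ℕ) : Lp ℂ 2 (volume : Measure ℝ) :=
  (memLp_two_ofReal_hermiteFun n).toLp _

theorem inner_hermiteLp_toLp {f : ℝ → ℂ} (hf : MemLp f 2 volume) (j : ℕ) :
    inner ℂ (hermiteLp j) (hf.toLp f) = complexHermiteCoeff f j := by
  rw [L2.inner_def, complexHermiteCoeff]
  refine integral_congr_ae ?_
  filter_upwards [hf.coeFn_toLp, (memLp_two_ofReal_hermiteFun j).coeFn_toLp] with x h1 h2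
  rw [hermiteLp, h1, h2, RCLike.inner_apply, Complex.conj_ofReal]

theorem complexHermiteCoeff_hermiteFun (j k : ℕ) :
    complexHermiteCoeff (fun x => (hermiteFun k x : ℂ)) j = if k = j then 1 else 0 := by
  simp only [complexHermiteCoeff, ← Complex.ofReal_mul]
  rw [integral_complex_ofReal, integral_hermiteFun_mul_hermiteFun]
  split_ifs <;> simp

theorem orthonormal_hermiteLp : Orthonormal ℂ hermiteLp := by
  rw [orthonormal_iff_ite]
  intro i j
  rw [hermiteLp.eq_1 j, inner_hermiteLp_toLp, complexHermiteCoeff_hermiteFun]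
  simp only [eq_comm]

theorem norm_toLp_sq {f : ℝ → ℂ} (hf : MemLp f 2 volume) :
    ‖hf.toLp f‖ ^ 2 = ∫ x, ‖f x‖ ^ 2 := by
  have h : ((‖hf.toLp f‖ ^ 2 : ℝ) : ℂ) = ((∫ x, ‖f x‖ ^ 2 : ℝ) : ℂ) := by
    rw [← integral_complex_ofReal]
    push_cast
    rw [← Complex.coe_algebraMap, ← inner_self_eq_norm_sq_to_K (𝕜 := ℂ), L2.inner_def]
    refine integral_congr_ae ?_
    filter_upwards [hf.coeFn_toLp] with x hx
    rw [hx, inner_self_eq_norm_sq_to_K]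
  exact_mod_cast h

/-- The Hilbert basis of `L²` given by the Hermite functions. -/
noncomputable def hermiteBasis : HilbertBasis ℕ ℂ (Lp ℂ 2 (volume : Measure ℝ)) :=
  HilbertBasis.mkOfOrthogonalEqBot orthonormal_hermiteLp (by
    rw [Submodule.eq_bot_iff]
    intro u hu
    have hm := Lp.memLp u
    have hc : ∀ j, ∫ x, u x * (hermiteFun j x : ℂ) = 0 := by
      intro j
      have h := (Submodule.mem_orthogonal _ _).1 hu (hermiteLp j)
        (Submodule.subset_span (Set.mem_range_self j))
      rwa [← Lp.toLp_coeFn u hm, inner_hermiteLp_toLp] at h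
    exact (Lp.eq_zero_iff_ae_eq_zero).2 (ae_eq_zero_of_integral_mul_hermiteFun_eq_zero hm hc))

theorem sum_norm_complexHermiteCoeff_sq_le {f : ℝ → ℂ} (hf : MemLp f 2 volume) (s : Finset ℕ) :
    ∑ j ∈ s, ‖complexHermiteCoeff f j‖ ^ 2 ≤ ∫ x, ‖f x‖ ^ 2 := by
  have h := orthonormal_hermiteLp.sum_inner_products_le (hf.toLp f) (s := s)
  simpa only [inner_hermiteLp_toLp, norm_toLp_sq] using h

/-- Parseval's identity for the Hermite functions. -/
theorem hasSum_norm_complexHermiteCoeff_sq {f : ℝ → ℂ} (hf : MemLp f 2 volume) :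
    HasSum (fun j => ‖complexHermiteCoeff f j‖ ^ 2) (∫ x, ‖f x‖ ^ 2) := by
  have h := hermiteBasis.hasSum_inner_mul_inner (hf.toLp f) (hf.toLp f)
  rw [inner_self_eq_norm_sq_to_K] at h
  have e : ∀ j, inner ℂ (hf.toLp f) (hermiteBasis j) * inner ℂ (hermiteBasis j) (hf.toLp f)
      = ((‖complexHermiteCoeff f j‖ ^ 2 : ℝ) : ℂ) := by
    intro j
    have hb : hermiteBasis j = hermiteLp j := by
      rw [hermiteBasis, HilbertBasis.coe_mkOfOrthogonalEqBot]
    rw [hb, ← inner_conj_symm, inner_hermiteLp_toLp, Complex.conj_mul']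
    push_cast; rfl
  simp only [e] at h
  change HasSum _ ((‖hf.toLp f‖ : ℂ) ^ 2) at h
  rw [← Complex.ofReal_pow, norm_toLp_sq] at h
  exact Complex.hasSum_ofReal.1 h

theorem memLp_two_sum_hermiteFun (s : Finset ℕ) (a : ℕ → ℂ) (σ : ℕ → ℕ) :
    MemLp (fun x => ∑ j ∈ s, a j * (hermiteFun (σ j) x : ℂ)) 2 volume :=
  memLp_finsetSum s fun j _ => (memLp_two_ofReal_hermiteFun (σ j)).const_mul (a j)

theorem complexHermiteCoeff_sum (s : Finset ℕ) (a : ℕ → ℂ) (k : ℕ) :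
    complexHermiteCoeff (fun x => ∑ j ∈ s, a j * (hermiteFun j x : ℂ)) k
      = if k ∈ s then a k else 0 := by
  have e : ∀ x, (∑ j ∈ s, a j * (hermiteFun j x : ℂ)) * (hermiteFun k x : ℂ)
      = ∑ j ∈ s, a j * ((hermiteFun j x : ℂ) * (hermiteFun k x : ℂ)) := by
    intro x
    rw [Finset.sum_mul]
    exact Finset.sum_congr rfl fun j _ => mul_assoc _ _ _
  rw [complexHermiteCoeff]
  simp only [e]
  rw [integral_finsetSum _ fun j _ =>
    (integrable_mul_hermiteFun (memLp_two_ofReal_hermiteFun j) k).const_mul (a j)]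
  have h : ∀ j, ∫ x, a j * ((hermiteFun j x : ℂ) * (hermiteFun k x : ℂ))
      = if j = k then a j else 0 := by
    intro j
    rw [integral_const_mul]
    have := complexHermiteCoeff_hermiteFun k j
    rw [complexHermiteCoeff] at this
    rw [this]
    split_ifs <;> simp
  simp only [h]
  rw [Finset.sum_ite_eq']

/-- The reindexing `σ` allows for the shift `j ↦ j + 1` produced by multiplication by `x`. -/
theorem integral_norm_sum_hermiteFun_sq (s : Finset ℕ) (a : ℕ → ℂ) {σ : ℕ → ℕ}
    (hσ : Function.Injective σ) :
    ∫ x, ‖∑ j ∈ s, a j * (hermiteFun (σ j) x : ℂ)‖ ^ 2 = ∑ j ∈ s, ‖a j‖ ^ 2 := by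
  have hm := memLp_two_sum_hermiteFun s a σ
  have hL : hm.toLp _ = ∑ j ∈ s, a j • hermiteLp (σ j) := by
    clear hσ
    induction s using Finset.induction_on with
    | empty =>
      simp only [Finset.sum_empty]
      exact MemLp.toLp_zero _
    | insert i s hi ih =>
      rw [Finset.sum_insert hi, ← ih (memLp_two_sum_hermiteFun s a σ), hermiteLp,
        ← MemLp.toLp_const_smul, ← MemLp.toLp_add]
      refine MemLp.toLp_congr _ _ (Eventually.of_forall fun x => ?_)
      simp [Finset.sum_insert hi]
  have ho := (orthonormal_hermiteLp.comp σ hσ).inner_sum a a s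
  simp only [Function.comp_apply] at ho
  rw [← norm_toLp_sq hm, hL]
  rw [inner_self_eq_norm_sq_to_K] at ho
  have e : ∀ j, (starRingEnd ℂ) (a j) * a j = ((‖a j‖ ^ 2 : ℝ) : ℂ) := fun j => by
    rw [Complex.conj_mul']; push_cast; rfl
  simp only [e] at ho
  change (‖∑ j ∈ s, a j • hermiteLp (σ j)‖ : ℂ) ^ 2 = _ at ho
  exact_mod_cast ho

/-! ### `L¹` bounds for the remainder of a Hermite expansion. -/

/-- AM-GM with weight `w = μ⁴ + x²`: `|r| ≤ w|r|²/(2μ) + μ/(2w)`, where the last term integrates to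
`π/(2μ)`. The fourth power is chosen so that `μ⁴ = p + 1` cancels the decay of `‖r‖₂²`. -/
theorem integrable_and_integral_norm_le {r : ℝ → ℂ} (hr : MemLp r 2 volume)
    (hxr : MemLp (fun x : ℝ => (x : ℂ) * r x) 2 volume) {μ : ℝ} (hμ : 0 < μ) :
    Integrable r ∧ ∫ x, ‖r x‖
      ≤ (μ ^ 4 * ∫ x, ‖r x‖ ^ 2) / (2 * μ) + (∫ x : ℝ, ‖(x : ℂ) * r x‖ ^ 2) / (2 * μ)
        + Real.pi / (2 * μ) := by
  have i1 : Integrable fun x => ‖r x‖ ^ 2 := hr.norm.integrable_sq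
  have i2 : Integrable fun x : ℝ => ‖(x : ℂ) * r x‖ ^ 2 := hxr.norm.integrable_sq
  have i3 : Integrable fun x : ℝ => (1 + (x / μ ^ 2) ^ 2)⁻¹ :=
    integrable_inv_one_add_sq.comp_div (by positivity)
  have hI3 : ∫ x : ℝ, (1 + (x / μ ^ 2) ^ 2)⁻¹ = μ ^ 2 * Real.pi := by
    rw [Measure.integral_comp_div (fun x : ℝ => (1 + x ^ 2)⁻¹), integral_univ_inv_one_add_sq,
      abs_of_pos (by positivity), smul_eq_mul]
  have i12 : Integrable fun x : ℝ =>
      μ ^ 4 / (2 * μ) * ‖r x‖ ^ 2 + (2 * μ)⁻¹ * ‖(x : ℂ) * r x‖ ^ 2 :=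
    (i1.const_mul _).add (i2.const_mul _)
  let B : ℝ → ℝ := fun x => μ ^ 4 / (2 * μ) * ‖r x‖ ^ 2 + (2 * μ)⁻¹ * ‖(x : ℂ) * r x‖ ^ 2
    + (2 * μ ^ 3)⁻¹ * (1 + (x / μ ^ 2) ^ 2)⁻¹
  have iB : Integrable B := i12.add (i3.const_mul _)
  have hB : ∀ x, ‖r x‖ ≤ B x := by
    intro x
    have hw : 0 < μ ^ 4 + x ^ 2 := by positivity
    have e1 : ‖(x : ℂ) * r x‖ ^ 2 = x ^ 2 * ‖r x‖ ^ 2 := by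
      rw [norm_mul, mul_pow, Complex.norm_real, Real.norm_eq_abs, sq_abs]
    have e2 : (1 + (x / μ ^ 2) ^ 2)⁻¹ = μ ^ 4 * (μ ^ 4 + x ^ 2)⁻¹ := by
      field_simp
    have e3 : B x - ‖r x‖ = ((μ ^ 4 + x ^ 2) * ‖r x‖ - μ) ^ 2 / (2 * μ * (μ ^ 4 + x ^ 2)) := by
      simp only [B]
      rw [e1, e2]
      field_simp
      ring
    have : 0 ≤ B x - ‖r x‖ := by rw [e3]; positivity
    linarith
  have ir : Integrable r := iB.mono' hr.aestronglyMeasurable (Eventually.of_forall hB)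
  refine ⟨ir, (integral_mono ir.norm iB hB).trans (le_of_eq ?_)⟩
  simp only [B]
  rw [integral_add i12 (i3.const_mul _),
    integral_add (i1.const_mul _) (i2.const_mul _), integral_const_mul, integral_const_mul,
    integral_const_mul, hI3]
  field_simp

theorem complexHermiteCoeff_sub_proj {f : ℝ → ℂ} (hf : MemLp f 2 volume) (p j : ℕ) :
    complexHermiteCoeff (fun x => f x - complexHermiteProj p f x) j
      = if j ∈ Finset.range (p + 1) then 0 else complexHermiteCoeff f j := by
  have h := complexHermiteCoeff_sum (Finset.range (p + 1)) (complexHermiteCoeff f) j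
  have e : complexHermiteCoeff (fun x => f x - complexHermiteProj p f x) j
      = complexHermiteCoeff f j - complexHermiteCoeff (fun x =>
        ∑ j ∈ Finset.range (p + 1), complexHermiteCoeff f j * (hermiteFun j x : ℂ)) j := by
    simp only [complexHermiteCoeff.eq_1 _ j, complexHermiteProj, sub_mul]
    exact integral_sub (integrable_mul_hermiteFun hf j)
      (integrable_mul_hermiteFun (memLp_two_sum_hermiteFun _ (complexHermiteCoeff f) id) j)
  rw [e, h]
  split_ifs <;> simp

/-- Parseval for the remainder: only indices `j ≥ p + 1` survive, and there the weight `j + 1`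
exceeds `p + 1`. -/
theorem mul_integral_norm_sub_proj_sq_le {f : ℝ → ℂ} (hf : MemLp f 2 volume) {K : ℝ}
    (hK : ∀ N, ∑ j ∈ Finset.range N, ((j : ℝ) + 1) * ‖complexHermiteCoeff f j‖ ^ 2 ≤ K) (p : ℕ) :
    ((p : ℝ) + 1) * ∫ x, ‖f x - complexHermiteProj p f x‖ ^ 2 ≤ K := by
  have hr : MemLp (fun x => f x - complexHermiteProj p f x) 2 volume :=
    hf.sub (memLp_two_sum_hermiteFun _ (complexHermiteCoeff f) id)
  have hs := ((hasSum_norm_complexHermiteCoeff_sq hr).mul_left ((p : ℝ) + 1)).tendsto_sum_nat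
  refine le_of_tendsto' hs fun N => le_trans (Finset.sum_le_sum fun j _ => ?_) (hK N)
  rw [complexHermiteCoeff_sub_proj hf]
  split_ifs with hj
  · simp; positivity
  · have : p + 1 ≤ j := by simpa using hj
    gcongr
    omega

/-- Multiplication by `x` does not commute with the projection, so `x Π_p f` needs its own bound:
half the sum of a raised part `A` and a lowered part `B`, each an orthogonal expansion. -/
theorem integral_norm_mul_proj_sq_le {f : ℝ → ℂ} {K : ℝ}
    (hK : ∀ N, ∑ j ∈ Finset.range N, ((j : ℝ) + 1) * ‖complexHermiteCoeff f j‖ ^ 2 ≤ K) (p : ℕ) :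
    MemLp (fun x : ℝ => (x : ℂ) * complexHermiteProj p f x) 2 volume ∧
      ∫ x : ℝ, ‖(x : ℂ) * complexHermiteProj p f x‖ ^ 2 ≤ 2 * K := by
  let c := complexHermiteCoeff f
  let a : ℕ → ℂ := fun j => ((√(2 * ((j + 1 : ℕ) : ℝ)) : ℝ) : ℂ) * c j
  let a' : ℕ → ℂ := fun j => ((√(2 * ((j + 1 : ℕ) : ℝ)) : ℝ) : ℂ) * c (j + 1)
  let A : ℝ → ℂ := fun x => ∑ j ∈ Finset.range (p + 1), a j * (hermiteFun (j + 1) x : ℂ)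
  let B : ℝ → ℂ := fun x => ∑ j ∈ Finset.range p, a' j * (hermiteFun j x : ℂ)
  have hA : MemLp A 2 volume := memLp_two_sum_hermiteFun _ a (· + 1)
  have hB : MemLp B 2 volume := memLp_two_sum_hermiteFun _ a' id
  have hAB : ∀ x : ℝ, (x : ℂ) * complexHermiteProj p f x = (1 / 2 : ℂ) * (A x + B x) := by
    intro x
    -- The `j = 0` term is zero because of `√0`, so the lowered sum reindexes to `range p`.
    have hB' : B x = ∑ j ∈ Finset.range (p + 1),
        ((√(2 * (j : ℝ)) : ℝ) : ℂ) * c j * (hermiteFun (j - 1) x : ℂ) := by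
      rw [Finset.sum_range_succ']
      simp [B, a']
    rw [hB', ← Finset.sum_add_distrib, complexHermiteProj, Finset.mul_sum, Finset.mul_sum]
    refine Finset.sum_congr rfl fun j _ => ?_
    have h := congrArg (fun y : ℝ => (y : ℂ)) (two_mul_mul_hermiteFun j x)
    simp only [Complex.ofReal_add, Complex.ofReal_mul, Complex.ofReal_ofNat] at h
    simp only [a, c]
    linear_combination (complexHermiteCoeff f j / 2) * h
  have hm : MemLp (fun x : ℝ => (x : ℂ) * complexHermiteProj p f x) 2 volume := by
    simp only [hAB]
    exact (hA.add hB).const_mul _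
  have iA : Integrable fun x => ‖A x‖ ^ 2 := hA.norm.integrable_sq
  have iB : Integrable fun x => ‖B x‖ ^ 2 := hB.norm.integrable_sq
  have hsq (j : ℕ) : ‖((√(2 * ((j + 1 : ℕ) : ℝ)) : ℝ) : ℂ)‖ ^ 2 = 2 * ((j : ℝ) + 1) := by
    rw [Complex.norm_real, Real.norm_eq_abs, sq_abs, Real.sq_sqrt (by positivity)]
    push_cast; ring
  have nA : ∫ x, ‖A x‖ ^ 2 ≤ 2 * K := by
    rw [integral_norm_sum_hermiteFun_sq _ a (σ := (· + 1)) (add_left_injective 1)]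
    refine le_trans (le_of_eq ?_) (mul_le_mul_of_nonneg_left (hK (p + 1)) zero_le_two)
    rw [Finset.mul_sum]
    refine Finset.sum_congr rfl fun j _ => ?_
    simp only [a, c]
    rw [norm_mul, mul_pow, hsq]; ring
  have nB : ∫ x, ‖B x‖ ^ 2 ≤ 2 * K := by
    have h := integral_norm_sum_hermiteFun_sq (Finset.range p) a' (σ := id) Function.injective_id
    simp only [id] at h
    rw [h]
    refine le_trans ?_ (mul_le_mul_of_nonneg_left (hK (p + 1)) zero_le_two)
    rw [Finset.sum_range_succ', mul_add, Finset.mul_sum]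
    refine le_add_of_le_of_nonneg (Finset.sum_le_sum fun j _ => ?_) (by positivity)
    simp only [a', c]
    rw [norm_mul, mul_pow, hsq, mul_assoc]
    gcongr
    linarith
  refine ⟨hm, ?_⟩
  calc ∫ x : ℝ, ‖(x : ℂ) * complexHermiteProj p f x‖ ^ 2
      ≤ ∫ x, ((1 / 2 : ℝ) * ‖A x‖ ^ 2 + (1 / 2 : ℝ) * ‖B x‖ ^ 2) := by
        refine integral_mono hm.norm.integrable_sq ((iA.const_mul _).add (iB.const_mul _))
          fun x => ?_
        have h1 : ‖(x : ℂ) * complexHermiteProj p f x‖ ≤ (1 / 2) * (‖A x‖ + ‖B x‖) := by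
          rw [hAB, norm_mul]
          have := norm_add_le (A x) (B x)
          norm_num
          linarith
        have h2 := pow_le_pow_left₀ (norm_nonneg _) h1 2
        have h3 := sq_nonneg (‖A x‖ - ‖B x‖)
        simp only
        nlinarith
    _ = (1 / 2 : ℝ) * (∫ x, ‖A x‖ ^ 2) + (1 / 2 : ℝ) * ∫ x, ‖B x‖ ^ 2 := by
        rw [integral_add (iA.const_mul _) (iB.const_mul _), integral_const_mul,
          integral_const_mul]
    _ ≤ 2 * K := by linarith

/-- A quantitative `L¹` bound on the tail of the Hermite expansion. -/
theorem integrable_sub_proj_and_integral_norm_le {f : ℝ → ℂ} (hf : MemLp f 2 volume)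
    (hxf : MemLp (fun x : ℝ => (x : ℂ) * f x) 2 volume) {K M : ℝ}
    (hK : ∀ N, ∑ j ∈ Finset.range N, ((j : ℝ) + 1) * ‖complexHermiteCoeff f j‖ ^ 2 ≤ K)
    (hM : ∫ x : ℝ, ‖(x : ℂ) * f x‖ ^ 2 ≤ M) (p : ℕ) :
    Integrable (fun x => f x - complexHermiteProj p f x) ∧
      ∫ x, ‖f x - complexHermiteProj p f x‖
        ≤ (2 * M + 5 * K + Real.pi) / (2 * √√((p : ℝ) + 1)) := by
  have hμ : 0 < √√((p : ℝ) + 1) := by positivity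
  have hμ4 : √√((p : ℝ) + 1) ^ 4 = (p : ℝ) + 1 := by
    rw [show 4 = 2 * 2 by rfl, pow_mul, Real.sq_sqrt (by positivity), Real.sq_sqrt (by positivity)]
  have hr : MemLp (fun x => f x - complexHermiteProj p f x) 2 volume :=
    hf.sub (memLp_two_sum_hermiteFun _ (complexHermiteCoeff f) id)
  obtain ⟨hxS, hS⟩ := integral_norm_mul_proj_sq_le hK p
  have hxr : MemLp (fun x : ℝ => (x : ℂ) * (f x - complexHermiteProj p f x)) 2 volume := by
    simp only [mul_sub]
    exact hxf.sub hxS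
  have hX : ∫ x : ℝ, ‖(x : ℂ) * (f x - complexHermiteProj p f x)‖ ^ 2 ≤ 2 * M + 4 * K := by
    have i1 : Integrable fun x : ℝ => ‖(x : ℂ) * f x‖ ^ 2 := hxf.norm.integrable_sq
    have i2 : Integrable fun x : ℝ => ‖(x : ℂ) * complexHermiteProj p f x‖ ^ 2 :=
      hxS.norm.integrable_sq
    calc ∫ x : ℝ, ‖(x : ℂ) * (f x - complexHermiteProj p f x)‖ ^ 2
        ≤ ∫ x : ℝ, (2 * ‖(x : ℂ) * f x‖ ^ 2 + 2 * ‖(x : ℂ) * complexHermiteProj p f x‖ ^ 2) := by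
          refine integral_mono hxr.norm.integrable_sq ((i1.const_mul _).add (i2.const_mul _))
            fun x => ?_
          have h1 := norm_sub_le ((x : ℂ) * f x) ((x : ℂ) * complexHermiteProj p f x)
          rw [← mul_sub] at h1
          have h2 := pow_le_pow_left₀ (norm_nonneg _) h1 2
          have h3 := sq_nonneg (‖(x : ℂ) * f x‖ - ‖(x : ℂ) * complexHermiteProj p f x‖)
          simp only
          nlinarith
      _ = 2 * (∫ x : ℝ, ‖(x : ℂ) * f x‖ ^ 2)
          + 2 * ∫ x : ℝ, ‖(x : ℂ) * complexHermiteProj p f x‖ ^ 2 := by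
          rw [integral_add (i1.const_mul _) (i2.const_mul _), integral_const_mul,
            integral_const_mul]
      _ ≤ 2 * M + 4 * K := by linarith
  obtain ⟨hi, hle⟩ := integrable_and_integral_norm_le hr hxr hμ
  refine ⟨hi, hle.trans ?_⟩
  rw [hμ4, ← add_div, ← add_div]
  have := mul_integral_norm_sub_proj_sq_le hf hK p
  refine div_le_div_of_nonneg_right ?_ (by positivity)
  linarith

/-! ### From the class conditions to uniform `L¹` rates. -/

/-- The maximum appears because `ENNReal.ofReal` truncates a negative `C` to zero. -/
theorem memLp_two_and_integral_norm_sq_le {f : ℝ → ℂ} (hf : AEStronglyMeasurable f volume) {C : ℝ}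
    (h : ∫⁻ x, ENNReal.ofReal (‖f x‖ ^ 2) ≤ ENNReal.ofReal C) :
    MemLp f 2 volume ∧ ∫ x, ‖f x‖ ^ 2 ≤ max C 0 := by
  have hm : AEStronglyMeasurable (fun x => ‖f x‖ ^ 2) volume := hf.norm.pow 2
  refine ⟨(memLp_two_iff_integrable_sq_norm hf).2 ⟨hm, ?_⟩, ?_⟩
  · rw [hasFiniteIntegral_iff_ofReal (Eventually.of_forall fun x => by positivity)]
    exact h.trans_lt ENNReal.ofReal_lt_top
  · rw [integral_eq_lintegral_of_nonneg_ae (Eventually.of_forall fun x => by positivity) hm,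
      ← ENNReal.toReal_ofReal']
    exact ENNReal.toReal_mono ENNReal.ofReal_ne_top h

theorem continuous_starTransform {g : ℝ → ℝ} (hg : Integrable g) :
    Continuous (starTransform g) := by
  refine continuous_of_dominated (bound := fun x => ‖g x‖)
    (fun t => (integrable_cexp_mul hg.ofReal t).aestronglyMeasurable)
    (fun t => Eventually.of_forall fun x => ?_) hg.norm (Eventually.of_forall fun x => ?_)
  · rw [norm_mul, norm_cexp_I_mul_mul, one_mul, Complex.norm_real]
  · fun_prop

theorem two_mul_complexHermiteCoeff_mul {f : ℝ → ℂ} (hf : MemLp f 2 volume) (n : ℕ) :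
    2 * complexHermiteCoeff (fun x : ℝ => (x : ℂ) * f x) n
      = (√(2 * ((n + 1 : ℕ) : ℝ)) : ℝ) * complexHermiteCoeff f (n + 1)
        + (√(2 * (n : ℝ)) : ℝ) * complexHermiteCoeff f (n - 1) := by
  simp only [complexHermiteCoeff]
  rw [← integral_const_mul, ← integral_const_mul, ← integral_const_mul,
    ← integral_add ((integrable_mul_hermiteFun hf _).const_mul _)
      ((integrable_mul_hermiteFun hf _).const_mul _)]
  congr 1; ext x
  have h := congrArg (fun y : ℝ => (y : ℂ)) (two_mul_mul_hermiteFun n x)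
  simp only [Complex.ofReal_add, Complex.ofReal_mul, Complex.ofReal_ofNat] at h
  linear_combination (f x) * h

theorem complexHermiteCoeff_ofReal (g : ℝ → ℝ) (j : ℕ) :
    complexHermiteCoeff (fun x => (g x : ℂ)) j = (hermiteCoeff g j : ℂ) := by
  rw [complexHermiteCoeff, hermiteCoeff, ← integral_complex_ofReal]
  simp only [Complex.ofReal_mul]

theorem complexHermiteProj_ofReal (p : ℕ) (g : ℝ → ℝ) (x : ℝ) :
    complexHermiteProj p (fun x => (g x : ℂ)) x = (hermiteProj p g x : ℂ) := by
  simp [complexHermiteProj, hermiteProj, complexHermiteCoeff_ofReal]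

theorem complexHermiteCoeff_starTransform {g : ℝ → ℝ} (hg : Integrable g) (j : ℕ) :
    complexHermiteCoeff (starTransform g) j
      = (√(2 * Real.pi) : ℝ) * Complex.I ^ j * (hermiteCoeff g j : ℂ) := by
  rw [complexHermiteCoeff, integral_starTransform_mul hg (integrable_hermiteFun j),
    hermiteCoeff, ← integral_complex_ofReal, ← integral_const_mul]
  congr 1; ext x
  rw [starTransform_hermiteFun]
  push_cast; ring

theorem integrable_hermiteProj (p : ℕ) (g : ℝ → ℝ) : Integrable (hermiteProj p g) :=
  integrable_finsetSum _ fun j _ => (integrable_hermiteFun j).const_mul _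

/-- The Fourier transform intertwines the Hermite projections. -/
theorem starTransform_hermiteProj {g : ℝ → ℝ} (hg : Integrable g) (p : ℕ) (t : ℝ) :
    starTransform (hermiteProj p g) t = complexHermiteProj p (starTransform g) t := by
  have e : ∀ x : ℝ, Complex.exp (Complex.I * t * x) * (hermiteProj p g x : ℂ)
      = ∑ j ∈ Finset.range (p + 1), (hermiteCoeff g j : ℂ)
        * (Complex.exp (Complex.I * t * x) * (hermiteFun j x : ℂ)) := by
    intro x
    rw [hermiteProj]
    push_cast
    rw [Finset.mul_sum]
    exact Finset.sum_congr rfl fun j _ => by ring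
  have hi (j : ℕ) : Integrable fun x : ℝ =>
      Complex.exp (Complex.I * t * x) * (hermiteFun j x : ℂ) :=
    integrable_cexp_mul (integrable_hermiteFun j).ofReal t
  rw [starTransform]
  simp only [e]
  rw [integral_finsetSum _ fun j _ => (hi j).const_mul _, complexHermiteProj]
  refine Finset.sum_congr rfl fun j _ => ?_
  rw [integral_const_mul, complexHermiteCoeff_starTransform hg]
  have h := starTransform_hermiteFun j t
  rw [starTransform] at h
  rw [h]; ring

/-- The Hermite coefficients are controlled by `‖x g‖₂` and `‖t g*‖₂`. -/
theorem sum_mul_hermiteCoeff_sq_le {g : ℝ → ℝ} (hg : Integrable g)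
    (hg2 : MemLp (fun x => (g x : ℂ)) 2 volume)
    (hxg : MemLp (fun x : ℝ => (x : ℂ) * (g x : ℂ)) 2 volume)
    (hs2 : MemLp (starTransform g) 2 volume)
    (hts : MemLp (fun t : ℝ => (t : ℂ) * starTransform g t) 2 volume) (N : ℕ) :
    ∑ j ∈ Finset.range N, ((j : ℝ) + 1) * hermiteCoeff g j ^ 2
      ≤ (∫ x : ℝ, ‖(x : ℂ) * (g x : ℂ)‖ ^ 2)
        + (2 * Real.pi)⁻¹ * ∫ t : ℝ, ‖(t : ℂ) * starTransform g t‖ ^ 2 := by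
  have hA := sum_norm_complexHermiteCoeff_sq_le hxg ((Finset.range N).map (addRightEmbedding 1))
  have hB := sum_norm_complexHermiteCoeff_sq_le hts ((Finset.range N).map (addRightEmbedding 1))
  rw [Finset.sum_map] at hA hB
  refine le_trans ?_ (add_le_add hA (mul_le_mul_of_nonneg_left hB (by positivity)))
  rw [Finset.mul_sum, ← Finset.sum_add_distrib]
  refine Finset.sum_le_sum fun j _ => ?_
  simp only [addRightEmbedding_apply]
  have a1 := two_mul_complexHermiteCoeff_mul hg2 (j + 1)
  have b1 := two_mul_complexHermiteCoeff_mul hs2 (j + 1)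
  simp only [complexHermiteCoeff_ofReal, Nat.add_sub_cancel] at a1
  simp only [complexHermiteCoeff_starTransform hg, Nat.add_sub_cancel] at b1
  -- At index `j + 1`, `x g` has coefficient `(u + v)/2` and `t g*` has `√(2π) i^j (v - u)/2`, since
  -- `i² = -1`. The normalised squares add up to `(u² + v²)/2 ≥ v²/2 = (j+1) α_j²`.
  set u := √(2 * ((j + 1 + 1 : ℕ) : ℝ)) * hermiteCoeff g (j + 1 + 1)
  set v := √(2 * ((j + 1 : ℕ) : ℝ)) * hermiteCoeff g j with hv
  have hvv : v ^ 2 = 2 * ((j : ℝ) + 1) * hermiteCoeff g j ^ 2 := by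
    rw [hv, mul_pow, Real.sq_sqrt (by positivity)]; push_cast; ring
  have a2 : 4 * ‖complexHermiteCoeff (fun x : ℝ => (x : ℂ) * (g x : ℂ)) (j + 1)‖ ^ 2
      = (u + v) ^ 2 := by
    have h : 2 * complexHermiteCoeff (fun x : ℝ => (x : ℂ) * (g x : ℂ)) (j + 1)
        = ((u + v : ℝ) : ℂ) := by rw [a1]; push_cast [u, v]; ring
    have h2 := congrArg (fun z : ℂ => ‖z‖ ^ 2) h
    simp only [norm_mul, mul_pow, Complex.norm_real, Real.norm_eq_abs, sq_abs,
      Complex.norm_ofNat] at h2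
    linarith
  have b2 : 4 * ‖complexHermiteCoeff (fun t : ℝ => (t : ℂ) * starTransform g t) (j + 1)‖ ^ 2
      = 2 * Real.pi * (v - u) ^ 2 := by
    have h : 2 * complexHermiteCoeff (fun t : ℝ => (t : ℂ) * starTransform g t) (j + 1)
        = (√(2 * Real.pi) : ℝ) * Complex.I ^ j * ((v - u : ℝ) : ℂ) := by
      rw [b1]; push_cast [u, v]
      linear_combination ((√(2 * ((j : ℝ) + 1 + 1)) : ℝ) * (√(2 * Real.pi) : ℝ) * Complex.I ^ j
        * (hermiteCoeff g (j + 1 + 1) : ℂ) : ℂ) * Complex.I_sq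
    have h2 := congrArg (fun z : ℂ => ‖z‖ ^ 2) h
    simp only [norm_mul, norm_pow, Complex.norm_I, one_pow, mul_one, mul_pow, Complex.norm_real,
      Real.norm_eq_abs, sq_abs, Complex.norm_ofNat,
      Real.sq_sqrt (show 0 ≤ 2 * Real.pi by positivity)] at h2
    linarith
  have b3 : (2 * Real.pi)⁻¹
      * ‖complexHermiteCoeff (fun t : ℝ => (t : ℂ) * starTransform g t) (j + 1)‖ ^ 2
      = (v - u) ^ 2 / 4 := by
    have hπ := Real.pi_pos
    field_simp
    linarith
  rw [b3]
  nlinarith [sq_nonneg u]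

theorem integral_norm_sub_hermiteProj_le {b Csob Cherm : ℝ} (hb : 1 ≤ b) {G : Measure ℝ}
    (hG : G ∈ hermiteSobolevClass b Csob Cherm) (p : ℕ) :
    (∫ x, ‖lebesgueDensity G x - hermiteProj p (lebesgueDensity G) x‖
      ≤ (7 * max Cherm 0 + 5 * max Csob 0 + Real.pi) / (2 * √√((p : ℝ) + 1))) ∧
    Integrable (starTransform (lebesgueDensity G)) ∧
    ∫ t, ‖starTransform (lebesgueDensity G) t
        - starTransform (hermiteProj p (lebesgueDensity G)) t‖
      ≤ (2 * Real.pi * (7 * max Csob 0 + 5 * max Cherm 0) + Real.pi)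
        / (2 * √√((p : ℝ) + 1)) := by
  obtain ⟨⟨hprob, -, hg1, hg2, hsob⟩, hherm⟩ := hG
  set g := lebesgueDensity G with hgdef
  have hg : Integrable g := memLp_one_iff_integrable.1 hg1
  have hg2' : MemLp (fun x => (g x : ℂ)) 2 volume := hg2.ofReal
  have hsc := continuous_starTransform hg
  -- The only use of `b ≥ 1`: the Sobolev weight dominates both `1` and `t²`.
  have hw (t : ℝ) : t ^ 2 + 1 ≤ (t ^ 2 + 1) ^ b :=
    Real.self_le_rpow_of_one_le (by nlinarith [sq_nonneg t]) hb
  obtain ⟨hxg, hxgle⟩ := memLp_two_and_integral_norm_sq_le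
    (f := fun x : ℝ => (x : ℂ) * (g x : ℂ)) (C := Cherm)
    ((Continuous.aestronglyMeasurable (by fun_prop)).mul hg2'.aestronglyMeasurable)
    (le_trans (le_of_eq (lintegral_congr fun x => by
      rw [norm_mul, mul_pow, Complex.norm_real, Complex.norm_real, Real.norm_eq_abs,
        Real.norm_eq_abs, sq_abs, sq_abs])) hherm)
  obtain ⟨hs2, -⟩ := memLp_two_and_integral_norm_sq_le (f := starTransform g)
    (C := 2 * Real.pi * Csob) hsc.aestronglyMeasurable
    (le_trans (lintegral_mono fun t => ENNReal.ofReal_le_ofReal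
      (le_mul_of_one_le_right (by positivity) (by nlinarith [hw t, sq_nonneg t]))) hsob)
  obtain ⟨hts, htsle⟩ := memLp_two_and_integral_norm_sq_le
    (f := fun t : ℝ => (t : ℂ) * starTransform g t) (C := 2 * Real.pi * Csob)
    (Continuous.aestronglyMeasurable (by fun_prop))
    (le_trans (lintegral_mono fun t => ENNReal.ofReal_le_ofReal (by
      rw [norm_mul, mul_pow, Complex.norm_real, Real.norm_eq_abs, sq_abs, mul_comm]
      exact mul_le_mul_of_nonneg_left (by linarith [hw t]) (by positivity))) hsob)
  have hmax : max (2 * Real.pi * Csob) 0 = 2 * Real.pi * max Csob 0 := by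
    rw [mul_max_of_nonneg _ _ (by positivity), mul_zero]
  rw [hmax] at htsle
  set K := max Cherm 0 + max Csob 0 with hK
  have hπ := Real.pi_pos
  have hcoef (N : ℕ) : ∑ j ∈ Finset.range N, ((j : ℝ) + 1) * hermiteCoeff g j ^ 2 ≤ K := by
    refine (sum_mul_hermiteCoeff_sq_le hg hg2' hxg hs2 hts N).trans (add_le_add hxgle ?_)
    rw [inv_mul_le_iff₀ (by positivity)]
    exact htsle
  obtain ⟨-, h1⟩ := integrable_sub_proj_and_integral_norm_le hg2' hxg (K := K) (fun N => by
    simpa only [complexHermiteCoeff_ofReal, Complex.norm_real, Real.norm_eq_abs, sq_abs]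
      using hcoef N) hxgle p
  have hcoef' (N : ℕ) : ∑ j ∈ Finset.range N,
      ((j : ℝ) + 1) * ‖complexHermiteCoeff (starTransform g) j‖ ^ 2 ≤ 2 * Real.pi * K := by
    refine le_trans (le_of_eq ?_) (mul_le_mul_of_nonneg_left (hcoef N) (by positivity))
    rw [Finset.mul_sum]
    refine Finset.sum_congr rfl fun j _ => ?_
    rw [complexHermiteCoeff_starTransform hg]
    simp only [norm_mul, norm_pow, Complex.norm_I, one_pow, mul_one, mul_pow, Complex.norm_real,
      Real.norm_eq_abs, sq_abs, Real.sq_sqrt (show 0 ≤ 2 * Real.pi by positivity)]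
    ring
  -- The same tail estimate on the Fourier side. It also makes `g*` integrable, as remainder plus a
  -- finite Hermite sum.
  obtain ⟨hi, h2⟩ := integrable_sub_proj_and_integral_norm_le hs2 hts hcoef' htsle p
  simp only [← starTransform_hermiteProj hg] at hi h2
  have his : Integrable (starTransform (hermiteProj p g)) := by
    rw [funext (starTransform_hermiteProj hg p)]
    exact integrable_finsetSum _ fun j _ => (integrable_hermiteFun j).ofReal.const_mul _
  refine ⟨?_, ?_, h2.trans (le_of_eq ?_)⟩
  · simp only [complexHermiteProj_ofReal, ← Complex.ofReal_sub, Complex.norm_real] at h1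
    refine h1.trans (le_of_eq ?_)
    rw [hK]; ring
  · exact (hi.add his).congr (Eventually.of_forall fun t => by simp)
  · rw [hK]; ring

/-! ### Continuity of the bias in `L¹`, and the conclusion. -/

theorem marginalDensity_eq_convolution (h : ℝ → ℝ) :
    marginalDensity h
      = convolution h (gaussianPDFReal 0 1) (ContinuousLinearMap.mul ℝ ℝ) volume := by
  ext x
  rw [marginalDensity, convolution]
  congr 1; ext μ
  exact mul_comm _ _

theorem integrable_marginalDensity {h : ℝ → ℝ} (hh : Integrable h) :
    Integrable (marginalDensity h) := by
  rw [marginalDensity_eq_convolution]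
  exact hh.integrable_convolution _ (integrable_gaussianPDFReal 0 1)

theorem integral_marginalDensity_eq_integral {h : ℝ → ℝ} (hh : Integrable h) :
    ∫ x, marginalDensity h x = ∫ x, h x := by
  rw [marginalDensity_eq_convolution,
    integral_convolution _ hh (integrable_gaussianPDFReal 0 1),
    integral_gaussianPDFReal_eq_one 0 one_ne_zero]
  simp

theorem integrable_gaussianPDFReal_mul {h : ℝ → ℝ} (hh : Integrable h) (x : ℝ) :
    Integrable fun μ => gaussianPDFReal 0 1 (x - μ) * h μ := by
  refine hh.bdd_mul (c := (√(2 * Real.pi * (1 : NNReal)))⁻¹)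
    ((measurable_gaussianPDFReal 0 1).comp (measurable_const.sub measurable_id)).aestronglyMeasurable
    (Eventually.of_forall fun μ => ?_)
  rw [Real.norm_of_nonneg (gaussianPDFReal_nonneg 0 1 _), gaussianPDFReal]
  exact mul_le_of_le_one_right (by positivity) (Real.exp_le_one_iff.2
    (div_nonpos_of_nonpos_of_nonneg (by nlinarith [sq_nonneg (x - μ - 0)]) (by simp)))

theorem marginalDensity_sub {u v : ℝ → ℝ} (hu : Integrable u) (hv : Integrable v) (x : ℝ) :
    marginalDensity (fun y => u y - v y) x = marginalDensity u x - marginalDensity v x := by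
  simp only [marginalDensity, mul_sub]
  exact integral_sub (integrable_gaussianPDFReal_mul hu x) (integrable_gaussianPDFReal_mul hv x)

theorem abs_marginalDensity_le (h : ℝ → ℝ) (x : ℝ) :
    |marginalDensity h x| ≤ marginalDensity (fun y => |h y|) x := by
  rw [marginalDensity, ← Real.norm_eq_abs]
  refine (norm_integral_le_integral_norm _).trans (le_of_eq ?_)
  rw [marginalDensity]
  congr 1; ext μ
  rw [norm_mul, Real.norm_of_nonneg (gaussianPDFReal_nonneg 0 1 _), Real.norm_eq_abs]

theorem abs_integral_mul_marginalDensity_sub_le {Q : ℝ → ℝ} (hQ_meas : Measurable Q) {CQ : ℝ}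
    (hQ : ∀ x, |Q x| ≤ CQ) {u v : ℝ → ℝ} (hu : Integrable u) (hv : Integrable v) :
    |(∫ x, Q x * marginalDensity u x) - ∫ x, Q x * marginalDensity v x|
      ≤ CQ * ∫ x, ‖v x - u x‖ := by
  have hi {h : ℝ → ℝ} (hh : Integrable h) : Integrable fun x => Q x * marginalDensity h x :=
    (integrable_marginalDensity hh).bdd_mul hQ_meas.aestronglyMeasurable (Eventually.of_forall hQ)
  have huv : Integrable fun y => u y - v y := hu.sub hv
  have hm := integrable_marginalDensity huv.abs
  rw [← integral_sub (hi hu) (hi hv), ← Real.norm_eq_abs]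
  calc ‖∫ x, (Q x * marginalDensity u x - Q x * marginalDensity v x)‖
      ≤ ∫ x, CQ * marginalDensity (fun y => |u y - v y|) x := by
        refine norm_integral_le_of_norm_le (hm.const_mul CQ) (Eventually.of_forall fun x => ?_)
        rw [← mul_sub, ← marginalDensity_sub hu hv, norm_mul]
        exact mul_le_mul (hQ x) (abs_marginalDensity_le _ x) (norm_nonneg _)
          ((abs_nonneg _).trans (hQ x))
    _ = CQ * ∫ x, ‖v x - u x‖ := by
        rw [integral_const_mul, integral_marginalDensity_eq_integral huv.abs]
        simp only [Real.norm_eq_abs, abs_sub_comm]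

theorem norm_fourierFunctional_sub_le {ψs : ℝ → ℂ} (hψ_meas : AEMeasurable ψs volume) {Cψ : ℝ}
    (hψ : ∀ t, ‖ψs t‖ ≤ Cψ) {u v : ℝ → ℝ} (hu : Integrable (starTransform u))
    (hv : Integrable (starTransform v)) :
    ‖fourierFunctional ψs u - fourierFunctional ψs v‖
      ≤ 1 / (2 * Real.pi) * (Cψ * ∫ t, ‖starTransform v t - starTransform u t‖) := by
  have hm : AEStronglyMeasurable (fun t => ψs (-t)) volume :=
    (hψ_meas.comp_quasiMeasurePreserving
      (Measure.measurePreserving_neg volume).quasiMeasurePreserving).aestronglyMeasurable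
  have hi {F : ℝ → ℂ} (hF : Integrable F) : Integrable fun t => ψs (-t) * F t :=
    hF.bdd_mul hm (Eventually.of_forall fun t => hψ (-t))
  rw [fourierFunctional, fourierFunctional, ← mul_sub, ← integral_sub (hi hu) (hi hv), norm_mul,
    ← integral_const_mul]
  refine mul_le_mul (le_of_eq ?_) ?_ (norm_nonneg _) (by positivity)
  · have h : (1 / (2 * Real.pi) : ℂ) = ((1 / (2 * Real.pi) : ℝ) : ℂ) := by push_cast; rfl
    rw [h, Complex.norm_real, Real.norm_of_nonneg (by positivity)]
  · refine norm_integral_le_of_norm_le ((hv.sub hu).norm.const_mul Cψ)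
      (Eventually.of_forall fun t => ?_)
    rw [← mul_sub, norm_mul, norm_sub_rev]
    exact mul_le_mul_of_nonneg_right (hψ (-t)) (norm_nonneg _)

/-- `Q₀` cancels, and the average of `m ≥ 1` equal means is a single mean, so the bound does not
depend on `m`. -/
theorem estimatorBias_sub {m : ℕ} (hm : 1 ≤ m) (Q₀ : ℝ) (Q : ℝ → ℝ) (L : (ℝ → ℝ) → ℂ)
    (u v : ℝ → ℝ) :
    estimatorBias m Q₀ Q L u - estimatorBias m Q₀ Q L v
      = (((∫ x, Q x * marginalDensity u x) - ∫ x, Q x * marginalDensity v x : ℝ) : ℂ)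
        - (L u - L v) := by
  have hmean (g : ℝ → ℝ) : estimatorMean m Q₀ Q g = Q₀ + ∫ x, Q x * marginalDensity g x := by
    have : (m : ℝ) ≠ 0 := by positivity
    rw [estimatorMean, Finset.sum_const, Finset.card_univ, Fintype.card_fin, nsmul_eq_mul]
    field_simp
  rw [estimatorBias, estimatorBias, hmean, hmean]
  push_cast; ring

theorem mainTheorem7 (b Csob Cherm : ℝ) (hb : 1 ≤ b)
    (ψs : ℝ → ℂ) (hψ_meas : AEMeasurable ψs volume) (Cψ : ℝ) (hψ : ∀ t, ‖ψs t‖ ≤ Cψ)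
    (m : ℕ) (hm : 1 ≤ m) (Q₀ : ℝ) (Q : ℝ → ℝ) (hQ_meas : Measurable Q)
    (hQ : ∃ CQ : ℝ, ∀ x, |Q x| ≤ CQ) :
    Tendsto
      (fun p : ℕ => excessBias m Q₀ Q (fourierFunctional ψs)
        (hermiteProj p '' (lebesgueDensity '' hermiteSobolevClass b Csob Cherm))
        (lebesgueDensity '' hermiteSobolevClass b Csob Cherm))
      atTop (𝓝 0) := by
  obtain ⟨CQ, hQ⟩ := hQ
  have hCQ : 0 ≤ CQ := (abs_nonneg _).trans (hQ 0)
  have hCψ : 0 ≤ Cψ := (norm_nonneg _).trans (hψ 0)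
  set E₁ := 7 * max Cherm 0 + 5 * max Csob 0 + Real.pi
  set E₂ := 2 * Real.pi * (7 * max Csob 0 + 5 * max Cherm 0) + Real.pi
  have hden : Tendsto (fun p : ℕ => 2 * √√((p : ℝ) + 1)) atTop atTop :=
    (Real.tendsto_sqrt_atTop.comp (Real.tendsto_sqrt_atTop.comp
      (tendsto_atTop_add_const_right _ 1 tendsto_natCast_atTop_atTop))).const_mul_atTop two_pos
  have hlim : Tendsto (fun p : ℕ => ENNReal.ofReal (CQ * (E₁ / (2 * √√((p : ℝ) + 1)))
      + 1 / (2 * Real.pi) * (Cψ * (E₂ / (2 * √√((p : ℝ) + 1)))))) atTop (𝓝 0) := by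
    have h (E : ℝ) := hden.const_div_atTop E
    simpa using ENNReal.tendsto_ofReal (((h E₁).const_mul CQ).add
      (((h E₂).const_mul Cψ).const_mul (1 / (2 * Real.pi))))
  refine tendsto_of_tendsto_of_tendsto_of_le_of_le tendsto_const_nhds hlim
    (fun p => zero_le) fun p => ?_
  -- The infimum is bounded by its value at the projection of `g` itself.
  refine iSup₂_le fun g hg => iInf₂_le_of_le (hermiteProj p g) (Set.mem_image_of_mem _ hg) ?_
  obtain ⟨G, hG, rfl⟩ := hg
  obtain ⟨h1, hi, h2⟩ := integral_norm_sub_hermiteProj_le hb hG p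
  have hg1 : Integrable (lebesgueDensity G) := memLp_one_iff_integrable.1 hG.1.2.2.1
  have hi' : Integrable (starTransform (hermiteProj p (lebesgueDensity G))) := by
    rw [funext (starTransform_hermiteProj hg1 p)]
    exact integrable_finsetSum _ fun j _ => (integrable_hermiteFun j).ofReal.const_mul _
  rw [← ofReal_norm, estimatorBias_sub hm]
  refine ENNReal.ofReal_le_ofReal ((norm_sub_le _ _).trans (add_le_add ?_ ?_))
  · rw [Complex.norm_real, Real.norm_eq_abs]
    exact (abs_integral_mul_marginalDensity_sub_le hQ_meas hQ (integrable_hermiteProj p _)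
      hg1).trans (mul_le_mul_of_nonneg_left h1 hCQ)
  · refine (norm_fourierFunctional_sub_le hψ_meas hψ hi' hi).trans ?_
    gcongr
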